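/- Throughout, $\log$ is the logarithm to base $2$ and $\|x\|$ is the distance from $x\in\mathbb{R}$ to the nearest integer. For real numbers $\gamma,\beta$ and an integer $N\ge 2$, let $\sigma_{(\gamma,\beta)}(N)\in(0,\infty]$ be the infimum of all $\sigma>0$ such that $\|k_1\gamma+k_2\beta\|\ge \max\{|k_1|,|k_2|\}^{-\sigma}$ for all integers $k_1,k_2$ with $2\le\max\{|k_1|,|k_2|\}\le N$ (it is $\infty$ if there is no such $\sigma$). For $\psi:\mathbb{N}\to[0,\infty)$ and real $\beta,\gamma,\gamma'$ let $$W(\psi,\beta,\gamma,\gamma')=\{x\in[0,1]:\ \|qx-\gamma\|\,\|q\beta-\gamma'\|<\psi(q)\ \text{for infinitely many integers } q\ge 1\}.$$ **Theorem 1.3.** Let $\psi:\mathbb{N}\to[0,\infty)$ satisfy $\psi(q)=O\big((q\,\log q\,(\log\log q)^{3})^{-1}\big)$ as $q\to\infty$. Let $\gamma,\beta$ be irrational numbers such that $\sigma_{(\gamma,\beta)}(q)=O\big((\log\log\log q)^{1/2}\big)$ as $q\to\infty$. Then for every $\epsilon>0$ there is a number $c$ with $0<c<\epsilon$, not depending on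 $\gamma'$, such that the following holds. Let $\omega:\{1,2,\dots\}\to\mathbb{R}$ be given by $\omega(q)=1$ if $q\le 4$ (that is, $\log\log q\le 1$) and $\omega(q)=c/(\log\log\log q)^{1/2}$ if $q>4$. Then for every real number $\gamma'$, if $$\sum_{\substack{q\ge 1\\ \|q\beta-\gamma'\|\in[q^{-\omega(q)},1)}}\frac{\psi(q)}{\|q\beta-\gamma'\|}=\infty,$$ then $W(\psi,\beta,\gamma,\gamma')$ has Lebesgue measure $1$. -/

import Mathlib

open Filter MeasureTheory

noncomputable section

/-- `‖x‖`: the distance from the real number `x` to the nearest integer. -/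
def distInt (x : ℝ) : ℝ := |x - round x|

/-- The binary logarithm. -/
def log₂ (x : ℝ) : ℝ := Real.logb 2 x

/-- `s` is an admissible exponent for the pair `(γ, β)` up to height `N`:
`‖k₁ γ + k₂ β‖ ≥ max(|k₁|, |k₂|) ^ (-s)` for all integer pairs of height at most `N`.
Pairs of height `1` are left out, since for them the right-hand side is `1` while the
distance to the nearest integer never exceeds `1 / 2`; the pair `(0, 0)` is left out too. -/
def IsAdmissibleExponent (γ β : ℝ) (N : ℕ) (s : ℝ) : Prop :=
  ∀ k₁ k₂ : ℤ, 2 ≤ max |k₁| |k₂| → max |k₁| |k₂| ≤ (N : ℤ) →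
    ((max |k₁| |k₂| : ℤ) : ℝ) ^ (-s) ≤ distInt ((k₁ : ℝ) * γ + (k₂ : ℝ) * β)

/-- The best Diophantine exponent `σ_{(γ, β)}(N) ∈ [0, ∞]` of the pair `(γ, β)` up to height `N`:
the infimum of all admissible `s > 0`. It is `∞` if there is no admissible `s`. -/
def jointExponent (γ β : ℝ) (N : ℕ) : ENNReal :=
  ⨅ (s : ℝ) (_ : 0 < s ∧ IsAdmissibleExponent γ β N s), ENNReal.ofReal s

/-- The function `ω` with parameter `c`: equal to `1` where `log log q ≤ 1` (that is, `q ≤ 4`),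
and to `c / (log log log q) ^ (1 / 2)` elsewhere. -/
def omegaFun (c : ℝ) (q : ℕ) : ℝ :=
  if log₂ (log₂ q) ≤ 1 then 1 else c / Real.sqrt (log₂ (log₂ (log₂ q)))

/-- `W(ψ, β, γ, γ')`: the `x ∈ [0, 1]` with `‖q x - γ‖ ‖q β - γ'‖ < ψ q` for infinitely many
positive integers `q`. -/
def fibredSet (ψ : ℕ → ℝ) (β γ γ' : ℝ) : Set ℝ :=
  {x | x ∈ Set.Icc (0 : ℝ) 1 ∧
    {q : ℕ | 0 < q ∧ distInt (q * x - γ) * distInt (q * β - γ') < ψ q}.Infinite}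

/-- The positive integers `q` with `‖q β - γ'‖ ∈ [q ^ (-ω q), 1)`. -/
def sumRange (ω : ℕ → ℝ) (β γ' : ℝ) : Set ℕ :=
  {q | 0 < q ∧ distInt (q * β - γ') ∈ Set.Ico ((q : ℝ) ^ (-ω q)) 1}

end

/-! Put `f q = ψ q / ‖qβ - γ'‖` and let `E_q` be the set of points of the circle with `‖qx - γ‖ < f
q`. On the range of summation `‖qβ - γ'‖` is positive, so a point in infinitely many `E_q` lies in
the required set. Multiplication by `q` preserves Haar measure, so `E_q` has measure `2 f q` once `f
q ≤ 1/2`, and the hypothesis says that these measures have divergent sum. Full measure follows from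
a second moment argument (`measure_setOf_infinite_eq_one`) if the pair overlaps sum to at most `(1 +
ε) (∑ |E_q|)² + O(∑ |E_q|)` for every `ε`. The constant tending to `1` makes a zero-one law
unnecessary.

With `g = gcd(q, r)`, averaging over torsion translates gives `|E_q ∩ E_r| ≤ 4 f q f r + 2 g min(f q
/ q, f r / r)`, and the overlap is empty unless `(q/g)γ` is close to `(r/g)γ` modulo `1`. The error
times `D = max(f q / q, f r / r) q r / g` is a constant multiple of `f q f r`, so pairs with `D ≥ K`
cost only a factor `1 + O(1/K)`. It remains to bound, for fixed `r`, the sum of `g min(f q / q, f r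
/ r)` over the close `q < r` with `D < K` by `O(f r)` (`volume_setOf_infinite_eq_one`).

This row sum is split by `d = gcd(q, r)`, with `q = p d`, `r = s d`. For small `d`, fix the dyadic
sizes of `s / p` and of `1 / ‖qβ - γ'‖`. Then `p (γ, dβ)` lies in a box modulo `1`, and the
Diophantine hypothesis bounds the number of such `p` by a multiple of the expected number
(`card_box_le`). The dyadic parameters cancel: each class costs `O(f r / (d Λ))` with `Λ = log r
(log log r)³` (`sum_dyadic_class_le`). There are `O((log log r + log d) log r)` classes, and `∑_{d ∣
r} (1 + log d) / d` is `O((log log r)²)`, which accounts exactly for the powers in `Λ`. For large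
`d` closeness alone forces the admissible `p` to be sparse, and a bound on the number of divisors of
`r` suffices (`RowBounds.sum_large_gcd_le`). -/

/-! ### Approximation sets on the circle and their pairwise overlaps. -/

theorem distInt_eq_norm (x : ℝ) : distInt x = ‖(x : UnitAddCircle)‖ :=
  UnitAddCircle.norm_eq.symm

/-- The points `x` of the circle with `‖q x - g‖ < a`. -/
def approxSet (q : ℕ) (g : UnitAddCircle) (a : ℝ) : Set UnitAddCircle :=
  {x | ‖q • x - g‖ < a}

theorem approxSet_eq_preimage (q : ℕ) (g : UnitAddCircle) (a : ℝ) :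
    approxSet q g a = (fun x => q • x) ⁻¹' Metric.ball g a := by
  ext x
  simp [approxSet, dist_eq_norm]

theorem measurableSet_approxSet (q : ℕ) (g : UnitAddCircle) (a : ℝ) :
    MeasurableSet (approxSet q g a) := by
  rw [approxSet_eq_preimage]
  exact (continuous_const_smul q).measurable measurableSet_ball

theorem measurePreserving_nsmul_circle {q : ℕ} (hq : q ≠ 0) :
    MeasurePreserving (fun x : UnitAddCircle => q • x) volume volume := by
  have h := Measure.measurePreserving_zsmul (volume : Measure UnitAddCircle) (n := (q : ℤ)) (by exact_mod_cast hq)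
  simpa using h

theorem volume_ball_circle (g : UnitAddCircle) (a : ℝ) :
    volume (Metric.ball g a) = ENNReal.ofReal (min 1 (2 * a)) := by
  rw [← measure_congr AddCircle.closedBall_ae_eq_ball, AddCircle.volume_closedBall]

theorem volume_approxSet {q : ℕ} (hq : q ≠ 0) (g : UnitAddCircle) (a : ℝ) :
    volume (approxSet q g a) = ENNReal.ofReal (min 1 (2 * a)) := by
  rw [approxSet_eq_preimage, (measurePreserving_nsmul_circle hq).measure_preimage
    measurableSet_ball.nullMeasurableSet, volume_ball_circle]

theorem one_le_mul_norm_of_nsmul_eq_zero {p : ℕ} (hp : 0 < p) {u : UnitAddCircle} (hu : p • u = 0)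
    (hu0 : u ≠ 0) : 1 ≤ p * ‖u‖ := by
  have hfin : IsOfFinAddOrder u := isOfFinAddOrder_iff_nsmul_eq_zero.2 ⟨p, hp, hu⟩
  have h := AddCircle.le_add_order_smul_norm_of_isOfFinAddOrder hfin hu0
  rw [nsmul_eq_mul] at h
  have h2 : addOrderOf u ≤ p := Nat.le_of_dvd hp (addOrderOf_dvd_of_nsmul_eq_zero hu)
  have h3 : (addOrderOf u : ℝ) ≤ p := by exact_mod_cast h2
  nlinarith [norm_nonneg u]

/-- A family of points of the circle which are translates of each other by distinct points killed
by `p` meets a ball of radius `b` at most `2 p b + 1` times. -/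
theorem card_ball_le {ι : Type*} (K : Finset ι) (z : ι → UnitAddCircle) {p : ℕ} (hp : 0 < p)
    (hz : ∀ i ∈ K, ∀ j ∈ K, p • (z i - z j) = 0) (hinj : Set.InjOn z K) (b : ℝ) (hb : 0 < b)
    (hball : ∀ i ∈ K, ‖z i‖ < b) : (K.card : ℝ) ≤ 2 * p * b + 1 := by
  have hp' : (0 : ℝ) < p := by exact_mod_cast hp
  have hp1 : (1 : ℝ) ≤ p := by exact_mod_cast hp
  have hdisj : (K : Set ι).PairwiseDisjoint (fun i => Metric.ball (z i) (1 / (2 * p))) := by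
    intro i hi j hj hij
    apply Metric.ball_disjoint_ball
    have hne : z i - z j ≠ 0 := sub_ne_zero.2 fun h => hij (hinj hi hj h)
    have := one_le_mul_norm_of_nsmul_eq_zero hp (hz i hi j hj) hne
    rw [dist_eq_norm, show (1 : ℝ) / (2 * p) + 1 / (2 * p) = 1 / p by field_simp; norm_num,
      div_le_iff₀ hp']
    linarith
  have hsub : (⋃ i ∈ K, Metric.ball (z i) (1 / (2 * (p : ℝ)))) ⊆
      Metric.ball 0 (b + 1 / (2 * p)) := by
    intro x hx
    simp only [Set.mem_iUnion] at hx
    obtain ⟨i, hi, hx⟩ := hx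
    have h1 := hball i hi
    rw [Metric.mem_ball, dist_eq_norm] at hx
    rw [mem_ball_zero_iff]
    calc ‖x‖ = ‖z i + (x - z i)‖ := by congr 1; abel
      _ ≤ ‖z i‖ + ‖x - z i‖ := norm_add_le _ _
      _ < _ := by linarith
  have hvol := measure_mono (μ := (volume : Measure UnitAddCircle)) hsub
  rw [measure_biUnion_finset hdisj (fun _ _ => measurableSet_ball)] at hvol
  simp only [volume_ball_circle] at hvol
  have hmin : min (1 : ℝ) (2 * (1 / (2 * p))) = 1 / p := by
    rw [show 2 * (1 / (2 * (p : ℝ))) = 1 / p by field_simp]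
    apply min_eq_right
    rw [div_le_iff₀ hp']; linarith
  rw [hmin, Finset.sum_const, nsmul_eq_mul, ← ENNReal.ofReal_natCast,
    ← ENNReal.ofReal_mul (by positivity),
    ENNReal.ofReal_le_ofReal_iff (by positivity)] at hvol
  have h2 := hvol.trans (min_le_right _ _)
  have h3 : (K.card : ℝ) * (1 / p) * p ≤ 2 * (b + 1 / (2 * p)) * p :=
    mul_le_mul_of_nonneg_right h2 hp'.le
  field_simp at h3
  linarith

theorem nsmul_inv_circle_eq_zero_iff {p : ℕ} (hp : 0 < p) (n : ℤ) :
    n • (((1 / p : ℝ)) : UnitAddCircle) = 0 ↔ (p : ℤ) ∣ n := by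
  have h : addOrderOf (((1 / p : ℝ)) : UnitAddCircle) = p := AddCircle.addOrderOf_period_div hp
  rw [← addOrderOf_dvd_iff_zsmul_eq_zero, h]

/-- The first set is invariant under translation by `1 / p`, so the overlap may be averaged over the
`p` translates of the second set. For fixed `x` the points `s (x + k / p) - g` are distinct because
`s` is prime to `p`, and they differ by `p`-torsion, so at most `2 p b + 1` of them lie in the ball
of radius `b`. Integrating over the first set gives the bound. -/
theorem volume_inter_approxSet_le_of_coprime {p s : ℕ} (hp : 0 < p) (hps : p.Coprime s)
    (g : UnitAddCircle) {a b : ℝ} (ha : 0 < a) (hb : 0 < b) :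
    (volume (approxSet p g a ∩ approxSet s g b)).toReal ≤ 4 * a * b + 2 * a / p := by
  have hp' : (0 : ℝ) < p := by exact_mod_cast hp
  set t : UnitAddCircle := ((1 / p : ℝ) : UnitAddCircle) with ht
  set U := approxSet p g a
  set V := approxSet s g b
  have hUm : MeasurableSet U := measurableSet_approxSet _ _ _
  have hVm : MeasurableSet V := measurableSet_approxSet _ _ _
  have hpt : p • t = 0 := by
    have := (nsmul_inv_circle_eq_zero_iff hp (p : ℤ)).2 dvd_rfl
    rwa [natCast_zsmul] at this
  have htrans : ∀ k : ℕ, volume (U ∩ V) = ∫⁻ x in U, ((fun x => x + k • t) ⁻¹' V).indicator 1 x := by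
    intro k
    rw [lintegral_indicator_one ((measurable_add_const _) hVm),
      Measure.restrict_apply ((measurable_add_const _) hVm),
      ← measure_preimage_add_right volume (k • t) (U ∩ V)]
    congr 1
    ext x
    have : p • (k • t) = 0 := by rw [smul_comm, hpt, smul_zero]
    simp only [Set.mem_preimage, Set.mem_inter_iff, U, approxSet, Set.mem_ofPred_eq, smul_add, this,
      add_zero]
    tauto
  have hcount : ∀ x : UnitAddCircle,
      ∑ k ∈ Finset.range p, ((fun x => x + k • t) ⁻¹' V).indicator (1 : UnitAddCircle → ENNReal) x
        ≤ ENNReal.ofReal (2 * p * b + 1) := by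
    classical
    intro x
    have : ∑ k ∈ Finset.range p, ((fun x => x + k • t) ⁻¹' V).indicator (1 : UnitAddCircle → ENNReal) x
        = (((Finset.range p).filter (fun k => x + k • t ∈ V)).card : ENNReal) := by
      rw [Finset.card_filter]
      push_cast
      exact Finset.sum_congr rfl fun k _ => by simp [Set.indicator]
    rw [this, ← ENNReal.ofReal_natCast]
    apply ENNReal.ofReal_le_ofReal
    have hdiff : ∀ i j : ℕ, (s • (x + i • t) - g) - (s • (x + j • t) - g)
        = (s * ((i : ℤ) - j)) • t := by
      intro i j
      rw [mul_smul, sub_smul, natCast_zsmul, natCast_zsmul, natCast_zsmul]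
      simp only [smul_add, smul_sub]; abel
    refine card_ball_le _ (fun k => s • (x + k • t) - g) hp ?_ ?_ b hb ?_
    · intro i _ j _
      rw [hdiff, ← natCast_zsmul (_ • t), smul_comm, natCast_zsmul, hpt, smul_zero]
    · intro i hi j hj hij
      dsimp only at hij
      rw [← sub_eq_zero, hdiff, nsmul_inv_circle_eq_zero_iff hp] at hij
      have hc : IsCoprime (p : ℤ) (s : ℤ) := Nat.isCoprime_iff_coprime.2 hps
      have h1 := hc.dvd_of_dvd_mul_left hij
      simp only [Finset.coe_filter, Finset.mem_range, Set.mem_ofPred_eq] at hi hj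
      have h2 : |(i : ℤ) - j| < p := by rw [abs_lt]; omega
      have := Int.eq_zero_of_abs_lt_dvd h1 h2
      omega
    · intro k hk
      exact (Finset.mem_filter.1 hk).2
  have hsum : (p : ENNReal) * volume (U ∩ V) ≤ ENNReal.ofReal (2 * p * b + 1) * volume U := by
    calc (p : ENNReal) * volume (U ∩ V) = ∑ k ∈ Finset.range p, volume (U ∩ V) := by simp
      _ = ∑ k ∈ Finset.range p, ∫⁻ x in U, ((fun x => x + k • t) ⁻¹' V).indicator 1 x :=
        Finset.sum_congr rfl fun k _ => htrans k
      _ = ∫⁻ x in U, ∑ k ∈ Finset.range p, ((fun x => x + k • t) ⁻¹' V).indicator 1 x := by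
        rw [lintegral_finsetSum]
        intro k _
        exact measurable_one.indicator ((measurable_add_const _) hVm)
      _ ≤ ∫⁻ x in U, ENNReal.ofReal (2 * p * b + 1) := lintegral_mono fun x => hcount x
      _ = _ := by simp
  have hU : volume U ≤ ENNReal.ofReal (2 * a) := by
    rw [volume_approxSet hp.ne']
    exact ENNReal.ofReal_le_ofReal (min_le_right _ _)
  have h2 := hsum.trans (mul_le_mul_right hU _)
  rw [← ENNReal.ofReal_mul (by positivity)] at h2
  have h3 := ENNReal.toReal_mono ENNReal.ofReal_ne_top h2
  rw [ENNReal.toReal_mul, ENNReal.toReal_natCast, ENNReal.toReal_ofReal (by positivity)] at h3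
  rw [show 4 * a * b + 2 * a / p = (2 * p * b + 1) * (2 * a) / p by field_simp; ring, le_div_iff₀ hp']
  linarith

theorem volume_inter_approxSet_le {p s d : ℕ} (hp : 0 < p) (hd : 0 < d) (hps : p.Coprime s)
    (g : UnitAddCircle) {a b : ℝ} (ha : 0 < a) (hb : 0 < b) :
    (volume (approxSet (p * d) g a ∩ approxSet (s * d) g b)).toReal ≤ 4 * a * b + 2 * a / p := by
  have h : approxSet (p * d) g a ∩ approxSet (s * d) g b
      = (fun x => d • x) ⁻¹' (approxSet p g a ∩ approxSet s g b) := by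
    ext x
    simp [approxSet, mul_smul]
  rw [h, (measurePreserving_nsmul_circle hd.ne').measure_preimage
    ((measurableSet_approxSet _ _ _).inter (measurableSet_approxSet _ _ _)).nullMeasurableSet]
  exact volume_inter_approxSet_le_of_coprime hp hps g ha hb

/-- A common point `x` is eliminated by forming `p (s d x - g) - s (p d x - g) = (s - p) g`. -/
theorem inter_approxSet_eq_empty {p s d : ℕ} (g : UnitAddCircle) {a b : ℝ}
    (h : s * a + p * b ≤ ‖((s : ℤ) - p) • g‖) (hs : 0 < s) :
    approxSet (p * d) g a ∩ approxSet (s * d) g b = ∅ := by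
  ext x
  simp only [approxSet, Set.mem_inter_iff, Set.mem_ofPred_eq, Set.mem_empty_iff_false, iff_false,
    not_and, not_lt]
  intro h1
  by_contra! h2
  have key : ((s : ℤ) - p) • g = p • ((s * d) • x - g) - s • ((p * d) • x - g) := by
    rw [sub_smul, natCast_zsmul, natCast_zsmul, smul_sub, smul_sub, ← mul_smul, ← mul_smul,
      show s * (p * d) = p * (s * d) by ring]
    abel
  have h3 : ‖((s : ℤ) - p) • g‖ ≤ p * ‖(s * d) • x - g‖ + s * ‖(p * d) • x - g‖ := by
    rw [key]
    exact (norm_sub_le _ _).trans (add_le_add (norm_nsmul_le) (norm_nsmul_le))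
  have hs' : (0 : ℝ) < s := by exact_mod_cast hs
  have hp' : (0 : ℝ) ≤ p := by positivity
  nlinarith [mul_le_mul_of_nonneg_left h2.le hp', mul_lt_mul_of_pos_left h1 hs']

/-! ### Second moments and the divergence Borel–Cantelli lemma. -/

section QuasiIndependence

variable {Ω : Type*} [MeasurableSpace Ω] (μ : Measure Ω) [IsProbabilityMeasure μ]

theorem integral_sum_indicator_sub_sq (A : ℕ → Set Ω) (hA : ∀ n, MeasurableSet (A n)) (N : ℕ)
    (S : ℝ) :
    ∫ x, (∑ n ∈ Finset.range N, (A n).indicator (1 : Ω → ℝ) x - S) ^ 2 ∂μ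
      = ∑ n ∈ Finset.range N, ∑ m ∈ Finset.range N, μ.real (A n ∩ A m)
        - 2 * S * ∑ n ∈ Finset.range N, μ.real (A n) + S ^ 2 := by
  have hint : ∀ B : Set Ω, MeasurableSet B → Integrable (B.indicator (1 : Ω → ℝ)) μ := fun B hB =>
    (integrable_const (1 : ℝ)).indicator hB
  have hexp : ∀ x, (∑ n ∈ Finset.range N, (A n).indicator (1 : Ω → ℝ) x - S) ^ 2
      = ∑ n ∈ Finset.range N, ∑ m ∈ Finset.range N, (A n ∩ A m).indicator (1 : Ω → ℝ) x
        - 2 * S * ∑ n ∈ Finset.range N, (A n).indicator (1 : Ω → ℝ) x + S ^ 2 := by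
    intro x
    simp_rw [Set.inter_indicator_one, Pi.mul_apply, ← Finset.sum_mul_sum]
    ring
  have h1 : Integrable (fun x => ∑ n ∈ Finset.range N, ∑ m ∈ Finset.range N,
      (A n ∩ A m).indicator (1 : Ω → ℝ) x) μ :=
    integrable_finsetSum _ fun n _ => integrable_finsetSum _ fun m _ =>
      hint _ ((hA n).inter (hA m))
  have h2 : Integrable (fun x => 2 * S * ∑ n ∈ Finset.range N, (A n).indicator (1 : Ω → ℝ) x) μ :=
    (integrable_finsetSum _ fun n _ => hint _ (hA n)).const_mul _
  simp_rw [hexp]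
  have h12 : Integrable (fun x => ∑ n ∈ Finset.range N, ∑ m ∈ Finset.range N,
      (A n ∩ A m).indicator (1 : Ω → ℝ) x
      - 2 * S * ∑ n ∈ Finset.range N, (A n).indicator (1 : Ω → ℝ) x) μ := h1.sub h2
  rw [integral_add h12 (integrable_const _), integral_sub h1 h2, integral_const_mul,
    integral_finsetSum _ fun n _ => integrable_finsetSum _ fun m _ =>
      hint _ ((hA n).inter (hA m)), integral_finsetSum _ fun n _ => hint _ (hA n)]
  have e1 : ∀ n, ∫ x, ∑ m ∈ Finset.range N, (A n ∩ A m).indicator (1 : Ω → ℝ) x ∂μ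
      = ∑ m ∈ Finset.range N, μ.real (A n ∩ A m) := by
    intro n
    rw [integral_finsetSum _ fun m _ => hint _ ((hA n).inter (hA m))]
    exact Finset.sum_congr rfl fun m _ => integral_indicator_one ((hA n).inter (hA m))
  simp_rw [e1, integral_indicator_one (hA _)]
  simp

/-- **Divergence Borel–Cantelli lemma** for sets which are independent on average. -/
theorem measure_setOf_infinite_eq_one (A : ℕ → Set Ω) (hA : ∀ n, MeasurableSet (A n))
    (hdiv : ¬ Summable fun n => μ.real (A n))
    (h : ∀ ε > 0, ∃ C : ℝ, ∀ N, ∑ n ∈ Finset.range N, ∑ m ∈ Finset.range N, μ.real (A n ∩ A m)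
      ≤ (1 + ε) * (∑ n ∈ Finset.range N, μ.real (A n)) ^ 2
        + C * ∑ n ∈ Finset.range N, μ.real (A n)) :
    μ {x | {n | x ∈ A n}.Infinite} = 1 := by
  set X : ℕ → Ω → ℝ := fun N x => ∑ n ∈ Finset.range N, (A n).indicator (1 : Ω → ℝ) x with hX
  set S : ℕ → ℝ := fun N => ∑ n ∈ Finset.range N, μ.real (A n) with hS
  have hStop : Tendsto S atTop atTop :=
    (not_summable_iff_tendsto_nat_atTop_of_nonneg fun n => measureReal_nonneg).1 hdiv
  have hXm : ∀ N, Measurable (X N) := fun N => by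
    refine Finset.measurable_sum _ fun n _ => measurable_one.indicator (hA n)
  -- The points whose counting function never exceeds `T`. Each such set is null by a Chebyshev
  -- argument, and together they cover the points lying in only finitely many `A n`.
  set B : ℕ → Set Ω := fun T => {x | ∀ N, X N x ≤ T} with hB
  have hBm : ∀ T, MeasurableSet (B T) := fun T => by
    have : B T = ⋂ N, {x | X N x ≤ T} := by ext x; simp [hB]
    rw [this]
    exact MeasurableSet.iInter fun N => measurableSet_le (hXm N) measurable_const
  have hB0 : ∀ T, μ (B T) = 0 := by
    intro T
    suffices hh : ∀ ε > 0, μ.real (B T) ≤ 8 * ε by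
      have h0 : μ.real (B T) = 0 := by
        refine le_antisymm (le_of_forall_pos_le_add fun ε hε => ?_) measureReal_nonneg
        have := hh (ε / 8) (by positivity)
        linarith
      rwa [measureReal_eq_zero_iff] at h0
    intro ε hε
    obtain ⟨C, hC⟩ := h ε hε
    -- Once `S N ≥ 2 T`, the counting function deviates from `S N` by at least `S N / 2` on `B T`;
    -- `S N ≥ C / ε` absorbs the linear term into `ε (S N)²`; `S N ≥ 1` allows division at the end.
    obtain ⟨N, hN1, hN2, hN3⟩ := ((hStop.eventually_ge_atTop (2 * T)).and
      ((hStop.eventually_ge_atTop (C / ε)).and (hStop.eventually_ge_atTop 1))).exists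
    have hv := integral_sum_indicator_sub_sq μ A hA N (S N)
    have hlow : μ.real (B T) * (S N - T) ^ 2 ≤ ∫ x, (X N x - S N) ^ 2 ∂μ := by
      have hi : Integrable (fun x => (X N x - S N) ^ 2) μ := by
        refine Integrable.of_bound (C := (N + |S N|) ^ 2)
          (((hXm N).sub_const _).pow_const 2).aestronglyMeasurable (ae_of_all _ fun x => ?_)
        rw [norm_pow, Real.norm_eq_abs]
        have h1 : |X N x| ≤ N := by
          refine (Finset.abs_sum_le_sum_abs _ _).trans ?_
          calc _ ≤ ∑ n ∈ Finset.range N, (1 : ℝ) := Finset.sum_le_sum fun n _ => by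
                by_cases hx : x ∈ A n <;> simp [hx]
            _ = N := by simp
        exact pow_le_pow_left₀ (abs_nonneg _) ((abs_sub _ _).trans (by linarith)) 2
      calc μ.real (B T) * (S N - T) ^ 2 = ∫ x, (B T).indicator (fun _ => (S N - T) ^ 2) x ∂μ := by
            rw [integral_indicator_const _ (hBm T), smul_eq_mul]
        _ ≤ _ := by
            refine integral_mono ((integrable_const _).indicator (hBm T)) hi fun x => ?_
            by_cases hx : x ∈ B T
            · simp only [hx, Set.indicator_of_mem]
              have := hx N
              nlinarith [Nat.cast_nonneg (α := ℝ) T]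
            · simp only [hx, not_false_eq_true, Set.indicator_of_notMem]
              positivity
    have hCN := hC N
    rw [div_le_iff₀ hε] at hN2
    have h1 : μ.real (B T) * (S N - T) ^ 2 ≤ 2 * ε * S N ^ 2 := by
      refine hlow.trans ?_
      rw [hv]
      nlinarith
    have h2 : S N ^ 2 / 4 ≤ (S N - T) ^ 2 := by nlinarith [Nat.cast_nonneg (α := ℝ) T]
    have h3 : μ.real (B T) * (S N ^ 2 / 4) ≤ 2 * ε * S N ^ 2 :=
      (mul_le_mul_of_nonneg_left h2 measureReal_nonneg).trans h1
    have h4 : 0 < S N ^ 2 := by positivity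
    by_contra! h5
    nlinarith
  have hcompl : {x | {n | x ∈ A n}.Infinite}ᶜ ⊆ ⋃ T, B T := by
    intro x hx
    simp only [Set.mem_compl_iff, Set.mem_ofPred_eq, Set.not_infinite] at hx
    rw [Set.mem_iUnion]
    refine ⟨hx.toFinset.card, fun N => ?_⟩
    classical
    have : X N x = (((Finset.range N).filter (fun n => x ∈ A n)).card : ℝ) := by
      rw [Finset.card_filter]
      push_cast
      exact Finset.sum_congr rfl fun n _ => by simp [Set.indicator]
    rw [this]
    exact_mod_cast Finset.card_le_card fun n hn => by simpa using (Finset.mem_filter.1 hn).2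
  have h0 : μ {x | {n | x ∈ A n}.Infinite}ᶜ = 0 :=
    measure_mono_null hcompl (measure_iUnion_null hB0)
  refine le_antisymm prob_le_one ?_
  have := measure_union_le (μ := μ) {x | {n | x ∈ A n}.Infinite} {x | {n | x ∈ A n}.Infinite}ᶜ
  rwa [Set.union_compl_self, measure_univ, h0, add_zero] at this

end QuasiIndependence

/-! ### Exponential sums and counting points of a linear sequence in a box. -/

/-- The additive character `x ↦ exp (2 π i x)`. -/
noncomputable def expTwoPi (x : ℝ) : ℂ := Complex.exp (((2 * Real.pi * x : ℝ) : ℂ) * Complex.I)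

theorem expTwoPi_add (x y : ℝ) : expTwoPi (x + y) = expTwoPi x * expTwoPi y := by
  simp only [expTwoPi, ← Complex.exp_add]; congr 1; push_cast; ring

theorem expTwoPi_int (n : ℤ) : expTwoPi n = 1 := by
  rw [expTwoPi, Complex.exp_eq_one_iff]
  exact ⟨n, by push_cast; ring⟩

theorem norm_expTwoPi (x : ℝ) : ‖expTwoPi x‖ = 1 := Complex.norm_exp_ofReal_mul_I _

theorem star_expTwoPi (x : ℝ) : (starRingEnd ℂ) (expTwoPi x) = expTwoPi (-x) := by
  rw [expTwoPi, expTwoPi, ← Complex.exp_conj]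
  congr 1
  rw [map_mul, Complex.conj_ofReal, Complex.conj_I]
  push_cast
  ring

theorem expTwoPi_nsmul (n : ℕ) (x : ℝ) : expTwoPi (n * x) = expTwoPi x ^ n := by
  rw [expTwoPi, expTwoPi, ← Complex.exp_nat_mul]; congr 1; push_cast; ring

theorem expTwoPi_re (x : ℝ) : (expTwoPi x).re = Real.cos (2 * Real.pi * x) := by
  rw [expTwoPi, Complex.exp_ofReal_mul_I_re]

theorem distInt_nonneg (x : ℝ) : 0 ≤ distInt x := abs_nonneg _

theorem distInt_le_half (x : ℝ) : distInt x ≤ 1 / 2 := abs_sub_round x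

theorem distInt_add_le (x y : ℝ) : distInt (x + y) ≤ distInt x + distInt y := by
  simp only [distInt_eq_norm, AddCircle.coe_add]; exact norm_add_le _ _

theorem distInt_sub_le (x y : ℝ) : distInt (x - y) ≤ distInt x + distInt y := by
  simp only [distInt_eq_norm, AddCircle.coe_sub]; exact norm_sub_le _ _

theorem expTwoPi_eq_sub_round (x : ℝ) : expTwoPi x = expTwoPi (x - round x) := by
  conv_lhs => rw [← sub_add_cancel x (round x), expTwoPi_add, expTwoPi_int, mul_one]

/-- The left side of `h1` is `2 sin(π ‖x‖)` squared, and Jordan's inequality bounds the sine below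
by its chord. -/
theorem norm_one_sub_expTwoPi_ge (x : ℝ) : 4 * distInt x ≤ ‖1 - expTwoPi x‖ := by
  rw [expTwoPi_eq_sub_round]
  set y := x - round x with hy
  have hd : distInt x = |y| := rfl
  have hy2 : |y| ≤ 1 / 2 := abs_sub_round x
  have h1 : ‖1 - expTwoPi y‖ ^ 2 = (2 * Real.sin (Real.pi * |y|)) ^ 2 := by
    have hs : Real.sin (Real.pi * |y|) ^ 2 = Real.sin (Real.pi * y) ^ 2 := by
      rcases abs_choice y with h | h <;> rw [h]
      simp
    rw [mul_pow, hs, ← Complex.normSq_eq_norm_sq, Complex.normSq_apply]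
    simp only [Complex.sub_re, Complex.one_re, Complex.sub_im, Complex.one_im, expTwoPi,
      Complex.exp_ofReal_mul_I_re, Complex.exp_ofReal_mul_I_im]
    rw [mul_assoc, Real.cos_two_mul, Real.sin_two_mul]
    linear_combination (4 * Real.cos (Real.pi * y) ^ 2 - 4) * Real.sin_sq_add_cos_sq (Real.pi * y)
  have h2 : 2 * |y| ≤ Real.sin (Real.pi * |y|) := by
    have := Real.mul_le_sin (x := Real.pi * |y|) (by positivity) (by nlinarith [Real.pi_pos])
    refine le_trans (le_of_eq ?_) this
    field_simp
  have h3 : 0 ≤ Real.sin (Real.pi * |y|) := le_trans (by positivity) h2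
  have := (pow_left_inj₀ (norm_nonneg _) (by positivity) two_ne_zero).1 h1
  rw [hd, this]; linarith

theorem norm_sum_expTwoPi_le (M : ℕ) (x : ℝ) (hx : 0 < distInt x) :
    ‖∑ n ∈ Finset.range M, expTwoPi ((n : ℝ) * x)‖ ≤ 1 / (2 * distInt x) := by
  have h := norm_one_sub_expTwoPi_ge x
  have hne : expTwoPi x ≠ 1 := fun h1 => by rw [h1] at h; simp at h; linarith
  simp_rw [expTwoPi_nsmul]
  rw [geom_sum_eq hne, norm_div, norm_sub_rev (expTwoPi x) 1, div_le_div_iff₀ (by linarith) (by linarith)]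
  have : ‖expTwoPi x ^ M - 1‖ ≤ 2 := by
    refine (norm_sub_le _ _).trans ?_
    rw [norm_pow, norm_expTwoPi]; norm_num
  nlinarith

/-- All angles are at most `π / 3` in absolute value, so every term has real part at least `1 / 2`.
-/
theorem norm_sum_expTwoPi_ge (A : ℕ) (x : ℝ) (hx : (A - 1) * distInt x ≤ 1 / 6) :
    (A : ℝ) / 2 ≤ ‖∑ k ∈ Finset.range A, expTwoPi ((k : ℝ) * x)‖ := by
  refine le_trans ?_ (Complex.re_le_norm _)
  rw [Complex.re_sum]
  have : ∀ k ∈ Finset.range A, (1 : ℝ) / 2 ≤ (expTwoPi ((k : ℝ) * x)).re := by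
    intro k hk
    rw [expTwoPi_nsmul, expTwoPi_eq_sub_round, ← expTwoPi_nsmul, expTwoPi_re, ← Real.cos_abs,
      ← Real.cos_pi_div_three]
    have hkA : (k : ℝ) ≤ A - 1 := by
      have := Finset.mem_range.1 hk
      have : (k : ℝ) + 1 ≤ A := by exact_mod_cast this
      linarith
    have h1 : (k : ℝ) * |x - round x| ≤ 1 / 6 :=
      (mul_le_mul_of_nonneg_right hkA (abs_nonneg _)).trans hx
    have h2 : |2 * Real.pi * (k * (x - round x))| = 2 * Real.pi * (k * |x - round x|) := by
      rw [abs_mul, abs_mul, abs_mul, abs_of_pos Real.pi_pos, abs_of_pos (two_pos : (0 : ℝ) < 2),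
        abs_of_nonneg (Nat.cast_nonneg k)]
    apply Real.cos_le_cos_of_nonneg_of_le_pi (abs_nonneg _)
    · linarith [Real.pi_pos]
    · rw [h2]; nlinarith [Real.pi_pos]
  have := Finset.card_nsmul_le_sum _ _ _ this
  rw [Finset.card_range, nsmul_eq_mul] at this
  linarith

/-- Upper bound for the number of points of a linear sequence on the torus in a box. -/
theorem card_box_mul_le (M A B : ℕ) (hA : 0 < A) (hB : 0 < B) (α₁ α₂ a b η ρ τ : ℝ) (hτ : 0 < τ)
    (hAη : ((A : ℝ) - 1) * η ≤ 1 / 6) (hBρ : ((B : ℝ) - 1) * ρ ≤ 1 / 6)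
    (hdio : ∀ k₁ k₂ : ℤ, |k₁| < A → |k₂| < B → (k₁, k₂) ≠ (0, 0) → τ ≤ distInt (k₁ * α₁ + k₂ * α₂))
    (X : Finset ℕ) (hX : X ⊆ Finset.range M) (h1 : ∀ n ∈ X, distInt (n * α₁ - a) ≤ η)
    (h2 : ∀ n ∈ X, distInt (n * α₂ - b) ≤ ρ) :
    (X.card : ℝ) ≤ 16 * M / (A * B) + 8 / τ := by
  have hA' : (1 : ℝ) ≤ A := by exact_mod_cast hA
  have hB' : (1 : ℝ) ≤ B := by exact_mod_cast hB
  set P : Finset (ℕ × ℕ) := Finset.range A ×ˢ Finset.range B with hP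
  have hPcard : (P.card : ℝ) = A * B := by simp [hP]
  -- A product of two Dirichlet kernels centred at `(a, b)`. It is at least `A B / 4` in modulus at
  -- every point of the box. Expanding its square summed over `n < M`, the diagonal contributes `A B
  -- M`, and every other frequency gives a geometric sum bounded by `1 / (2 τ)`.
  set F : ℕ → ℂ := fun n => ∑ p ∈ P, expTwoPi (p.1 * (n * α₁ - a) + p.2 * (n * α₂ - b)) with hF
  have hFprod : ∀ n, F n = (∑ k ∈ Finset.range A, expTwoPi ((k : ℝ) * (n * α₁ - a)))
      * ∑ l ∈ Finset.range B, expTwoPi ((l : ℝ) * (n * α₂ - b)) := by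
    intro n
    rw [Finset.sum_mul_sum, ← Finset.sum_product']
    exact Finset.sum_congr rfl fun p _ => expTwoPi_add _ _
  have hlow : ∀ n ∈ X, ((A : ℝ) * B / 4) ^ 2 ≤ ‖F n‖ ^ 2 := by
    intro n hn
    apply pow_le_pow_left₀ (by positivity)
    rw [hFprod, norm_mul]
    have e1 := norm_sum_expTwoPi_ge A (n * α₁ - a)
      ((mul_le_mul_of_nonneg_left (h1 n hn) (by linarith)).trans hAη)
    have e2 := norm_sum_expTwoPi_ge B (n * α₂ - b)
      ((mul_le_mul_of_nonneg_left (h2 n hn) (by linarith)).trans hBρ)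
    calc (A : ℝ) * B / 4 = A / 2 * (B / 2) := by ring
      _ ≤ _ := mul_le_mul e1 e2 (by positivity) (norm_nonneg _)
  have hsq : ∀ n : ℕ, ((‖F n‖ ^ 2 : ℝ) : ℂ) = ∑ p ∈ P, ∑ p' ∈ P,
      expTwoPi (-(((p.1 : ℤ) - p'.1 : ℤ) * a + ((p.2 : ℤ) - p'.2 : ℤ) * b)) *
      expTwoPi (n * ((((p.1 : ℤ) - p'.1 : ℤ) : ℝ) * α₁ + (((p.2 : ℤ) - p'.2 : ℤ) : ℝ) * α₂)) := by
    intro n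
    push_cast
    rw [← Complex.mul_conj', map_sum, Finset.sum_mul_sum]
    refine Finset.sum_congr rfl fun p _ => Finset.sum_congr rfl fun p' _ => ?_
    rw [star_expTwoPi, ← expTwoPi_add, ← expTwoPi_add]
    congr 1; ring
  have hup : ∑ n ∈ Finset.range M, ‖F n‖ ^ 2 ≤ A * B * M + (A * B) ^ 2 * (1 / (2 * τ)) := by
    have e0 : ∑ n ∈ Finset.range M, ‖F n‖ ^ 2 = ‖∑ n ∈ Finset.range M, ((‖F n‖ ^ 2 : ℝ) : ℂ)‖ := by
      rw [← Complex.ofReal_sum, Complex.norm_real, Real.norm_of_nonneg]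
      exact Finset.sum_nonneg fun _ _ => by positivity
    rw [e0]
    simp_rw [hsq]
    rw [Finset.sum_comm]
    have e1 : ∀ p ∈ P, ‖∑ n ∈ Finset.range M, ∑ p' ∈ P,
      expTwoPi (-(((p.1 : ℤ) - p'.1 : ℤ) * a + ((p.2 : ℤ) - p'.2 : ℤ) * b)) *
      expTwoPi (n * ((((p.1 : ℤ) - p'.1 : ℤ) : ℝ) * α₁ + (((p.2 : ℤ) - p'.2 : ℤ) : ℝ) * α₂))‖
        ≤ M + A * B * (1 / (2 * τ)) := by
      intro p hp
      rw [Finset.sum_comm]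
      have e2 : ∀ p' ∈ P, ‖∑ n ∈ Finset.range M,
          expTwoPi (-(((p.1 : ℤ) - p'.1 : ℤ) * a + ((p.2 : ℤ) - p'.2 : ℤ) * b)) *
          expTwoPi (n * ((((p.1 : ℤ) - p'.1 : ℤ) : ℝ) * α₁ + (((p.2 : ℤ) - p'.2 : ℤ) : ℝ) * α₂))‖
          ≤ (if p = p' then (M : ℝ) else 0) + 1 / (2 * τ) := by
        intro p' hp'
        rw [← Finset.mul_sum, norm_mul, norm_expTwoPi, one_mul]
        by_cases hpp : p = p'
        · rw [if_pos hpp]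
          have : ‖∑ n ∈ Finset.range M, expTwoPi (n * ((((p.1 : ℤ) - p'.1 : ℤ) : ℝ) * α₁
              + (((p.2 : ℤ) - p'.2 : ℤ) : ℝ) * α₂))‖ ≤ M := by
            refine (norm_sum_le _ _).trans ?_
            simp [norm_expTwoPi]
          have : 0 < 1 / (2 * τ) := by positivity
          linarith
        · rw [if_neg hpp, zero_add]
          simp only [hP, Finset.mem_product, Finset.mem_range] at hp hp'
          have hd := hdio ((p.1 : ℤ) - p'.1) ((p.2 : ℤ) - p'.2) (by rw [abs_lt]; omega)
            (by rw [abs_lt]; omega) (by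
              intro h
              apply hpp
              rw [Prod.mk.injEq] at h
              ext <;> omega)
          refine (norm_sum_expTwoPi_le M _ (hτ.trans_le hd)).trans ?_
          gcongr
      refine (norm_sum_le _ _).trans ((Finset.sum_le_sum e2).trans ?_)
      rw [Finset.sum_add_distrib, Finset.sum_ite_eq, if_pos hp, Finset.sum_const, nsmul_eq_mul, hPcard]
    refine (norm_sum_le _ _).trans ((Finset.sum_le_sum e1).trans ?_)
    rw [Finset.sum_const, nsmul_eq_mul, hPcard]
    apply le_of_eq; ring
  have hfin : (X.card : ℝ) * ((A : ℝ) * B / 4) ^ 2 ≤ A * B * M + (A * B) ^ 2 * (1 / (2 * τ)) := by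
    refine le_trans ?_ hup
    rw [← nsmul_eq_mul]
    exact (Finset.card_nsmul_le_sum _ _ _ hlow).trans
      (Finset.sum_le_sum_of_subset_of_nonneg hX fun _ _ _ => by positivity)
  have hAB : (0 : ℝ) < A * B := by positivity
  rw [← mul_le_mul_iff_left₀ (show (0 : ℝ) < ((A : ℝ) * B / 4) ^ 2 by positivity)]
  refine hfin.trans (le_of_eq ?_)
  field_simp
  ring

/-- Equidistribution upper bound at scale `η × ρ`, with frequencies only up to `1 / η`, `1 / ρ`. -/
theorem card_box_le (M : ℕ) (α₁ α₂ a b η ρ τ : ℝ) (hη : 0 < η) (hρ : 0 < ρ) (hτ : 0 < τ)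
    (hdio : ∀ k₁ k₂ : ℤ, (|k₁| : ℤ) ≤ 1 / η → (|k₂| : ℤ) ≤ 1 / ρ → (k₁, k₂) ≠ (0, 0) →
      τ ≤ distInt (k₁ * α₁ + k₂ * α₂))
    (X : Finset ℕ) (hX : X ⊆ Finset.range M) (h1 : ∀ n ∈ X, distInt (n * α₁ - a) ≤ η)
    (h2 : ∀ n ∈ X, distInt (n * α₂ - b) ≤ ρ) :
    (X.card : ℝ) ≤ 576 * M * η * ρ + 8 / τ := by
  -- The kernel length is `⌊1 / (6 t)⌋ + 1`: short enough for no cancellation on a box of half-width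
  -- `t`, long enough that its inverse is at most `6 t`. The two factors `6` turn `16` into `576`.
  have key : ∀ t : ℝ, 0 < t → ∃ A : ℕ, 0 < A ∧ ((A : ℝ) - 1) * t ≤ 1 / 6 ∧ 1 / (A : ℝ) ≤ 6 * t ∧
      ∀ k : ℤ, |k| < A → ((|k| : ℤ) : ℝ) ≤ 1 / t := by
    intro t ht
    have hfl : ((⌊1 / (6 * t)⌋₊ : ℕ) : ℝ) ≤ 1 / (6 * t) := Nat.floor_le (by positivity)
    refine ⟨⌊1 / (6 * t)⌋₊ + 1, by omega, ?_, ?_, ?_⟩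
    · push_cast
      rw [add_sub_cancel_right]
      calc _ ≤ 1 / (6 * t) * t := by gcongr
        _ = 1 / 6 := by field_simp
    · have := Nat.lt_floor_add_one (1 / (6 * t))
      push_cast
      rw [div_le_iff₀ (by positivity)]
      rw [div_lt_iff₀ (by positivity)] at this
      linarith
    · intro k hk
      have h3 : |k| ≤ (⌊1 / (6 * t)⌋₊ : ℕ) := by push_cast at hk; omega
      have h4 : ((|k| : ℤ) : ℝ) ≤ (⌊1 / (6 * t)⌋₊ : ℕ) := by exact_mod_cast h3
      refine (h4.trans hfl).trans ?_
      gcongr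
      linarith
  obtain ⟨A, hA, hA1, hA2, hA3⟩ := key η hη
  obtain ⟨B, hB, hB1, hB2, hB3⟩ := key ρ hρ
  refine (card_box_mul_le M A B hA hB α₁ α₂ a b η ρ τ hτ hA1 hB1
    (fun k₁ k₂ h h' => hdio k₁ k₂ (hA3 _ h) (hB3 _ h')) X hX h1 h2).trans ?_
  have : 16 * (M : ℝ) / (A * B) = 16 * M * ((1 / A) * (1 / B)) := by
    rw [one_div_mul_one_div]; ring
  rw [this]
  have h5 : (1 / (A : ℝ)) * (1 / B) ≤ (6 * η) * (6 * ρ) := by gcongr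
  nlinarith [mul_le_mul_of_nonneg_left h5 (show (0 : ℝ) ≤ 16 * M by positivity)]

/-! ### Sums over divisors and the number of divisors. -/

open ArithmeticFunction in
theorem sum_vonMangoldt_mul_div (n : ℕ) :
    ∑ m ∈ Finset.Ioc 0 n, vonMangoldt m * ((n / m : ℕ) : ℝ) = Real.log n.factorial := by
  induction n with
  | zero => simp
  | succ n ih =>
    rw [Nat.factorial_succ, Nat.cast_mul, Real.log_mul (by positivity) (by positivity), ← ih,
      ← vonMangoldt_sum]
    have h1 : ∀ m ∈ Finset.Ioc 0 (n + 1), vonMangoldt m * (((n + 1) / m : ℕ) : ℝ)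
        = vonMangoldt m * ((n / m : ℕ) : ℝ) + if m ∣ n + 1 then vonMangoldt m else 0 := by
      intro m _
      rw [Nat.succ_div]
      split_ifs <;> push_cast <;> ring
    rw [Finset.sum_congr rfl h1, Finset.sum_add_distrib, ← Finset.sum_filter]
    rw [add_comm (∑ i ∈ (n + 1).divisors, _)]
    refine congrArg₂ (· + ·) ?_ (Finset.sum_congr ?_ fun _ _ => rfl)
    · rw [Finset.sum_Ioc_succ_top (by omega)]
      simp
    · ext m
      simp only [Finset.mem_filter, Finset.mem_Ioc, Nat.mem_divisors]
      constructor
      · rintro ⟨_, h⟩; exact ⟨h, by omega⟩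
      · rintro ⟨h, _⟩; exact ⟨⟨Nat.pos_of_dvd_of_pos h (by omega), Nat.le_of_dvd (by omega) h⟩, h⟩

-- The upper half of Mertens' estimate: replace `n / m` by its integer part plus one, then use `log
-- n! ≤ n log n` and Chebyshev's bound for `ψ`.
open ArithmeticFunction in
theorem sum_vonMangoldt_div_le (n : ℕ) (hn : 0 < n) :
    ∑ m ∈ Finset.Ioc 0 n, vonMangoldt m / m ≤ Real.log n + 6 := by
  have hn' : (0 : ℝ) < n := by exact_mod_cast hn
  have h1 : ∀ m ∈ Finset.Ioc 0 n, n * (vonMangoldt m / m)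
      ≤ vonMangoldt m * ((n / m : ℕ) : ℝ) + vonMangoldt m := by
    intro m hm
    have hm' : (0 : ℝ) < m := by exact_mod_cast (Finset.mem_Ioc.1 hm).1
    have h2 : (n : ℝ) / m ≤ ((n / m : ℕ) : ℝ) + 1 := by
      rw [div_le_iff₀ hm']
      exact_mod_cast (Nat.lt_mul_div_succ n (Finset.mem_Ioc.1 hm).1).le.trans_eq (mul_comm _ _)
    calc n * (vonMangoldt m / m) = vonMangoldt m * (n / m) := by ring
      _ ≤ vonMangoldt m * (((n / m : ℕ) : ℝ) + 1) := by gcongr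
      _ = _ := by ring
  have h2 := Finset.sum_le_sum h1
  rw [← Finset.mul_sum, Finset.sum_add_distrib, sum_vonMangoldt_mul_div] at h2
  have h3 : ∑ m ∈ Finset.Ioc 0 n, vonMangoldt m ≤ (Real.log 4 + 4) * n := by
    have := Chebyshev.psi_le_const_mul_self (x := (n : ℝ)) hn'.le
    rwa [Chebyshev.psi, Nat.floor_natCast] at this
  have h4 : Real.log n.factorial ≤ n * Real.log n := by
    rw [← Real.log_pow]
    apply Real.log_le_log (by positivity)
    exact_mod_cast Nat.factorial_le_pow n
  have h5 : Real.log 4 ≤ 2 := by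
    rw [show (4 : ℝ) = 2 ^ 2 by norm_num, Real.log_pow]
    have := Real.log_two_lt_d9
    push_cast; linarith
  have h6 : n * ∑ m ∈ Finset.Ioc 0 n, vonMangoldt m / m ≤ n * (Real.log n + 6) := by
    refine h2.trans ((add_le_add h4 h3).trans ?_)
    nlinarith
  exact le_of_mul_le_mul_left h6 hn'

-- Divisors up to `Z` fall under Mertens' estimate; for the others `1 / m ≤ 1 / Z`, and the von
-- Mangoldt function sums to `log r` over the divisors of `r`.
open ArithmeticFunction in
theorem sum_divisors_vonMangoldt_div_le (r Z : ℕ) (hZ : 0 < Z) :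
    ∑ m ∈ r.divisors, vonMangoldt m / m ≤ Real.log Z + 6 + Real.log r / Z := by
  have hZ' : (0 : ℝ) < Z := by exact_mod_cast hZ
  rw [← Finset.sum_filter_add_sum_filter_not r.divisors (fun m => m ≤ Z)]
  apply add_le_add
  · refine le_trans (Finset.sum_le_sum_of_subset_of_nonneg ?_ ?_) (sum_vonMangoldt_div_le Z hZ)
    · intro m hm
      rw [Finset.mem_filter] at hm
      exact Finset.mem_Ioc.2 ⟨Nat.pos_of_mem_divisors hm.1, hm.2⟩
    · intro m _ _
      exact div_nonneg vonMangoldt_nonneg (Nat.cast_nonneg _)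
  · rw [← vonMangoldt_sum, Finset.sum_div]
    refine le_trans (Finset.sum_le_sum (g := fun m => vonMangoldt m / (Z : ℝ)) ?_)
      (Finset.sum_le_sum_of_subset_of_nonneg (Finset.filter_subset _ _) ?_)
    · intro m hm
      have : Z < m := not_le.1 (Finset.mem_filter.1 hm).2
      have : (Z : ℝ) ≤ m := by exact_mod_cast this.le
      exact div_le_div_of_nonneg_left vonMangoldt_nonneg hZ' this
    · intro m _ _
      exact div_nonneg vonMangoldt_nonneg hZ'.le

theorem sum_divisors_filter_dvd_inv_le (r m : ℕ) (hm : m ∈ r.divisors) :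
    ∑ d ∈ r.divisors.filter (fun d => m ∣ d), (1 : ℝ) / d ≤ 1 / m * ∑ e ∈ r.divisors, (1 : ℝ) / e := by
  have hm0 : 0 < m := Nat.pos_of_mem_divisors hm
  have h1 : ∑ d ∈ r.divisors.filter (fun d => m ∣ d), (1 : ℝ) / d
      = ∑ d ∈ r.divisors.filter (fun d => m ∣ d), 1 / (m : ℝ) * (1 / ((d / m : ℕ) : ℝ)) := by
    refine Finset.sum_congr rfl fun d hd => ?_
    obtain ⟨e, rfl⟩ := (Finset.mem_filter.1 hd).2
    rw [Nat.mul_div_cancel_left _ hm0, one_div_mul_one_div]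
    push_cast; rfl
  rw [h1, ← Finset.mul_sum]
  refine mul_le_mul_of_nonneg_left ?_ (by positivity)
  have hinj : Set.InjOn (fun d => d / m) (r.divisors.filter (fun d => m ∣ d) : Finset ℕ) := by
    intro a ha b hb hab
    have ha := (Finset.mem_filter.1 (Finset.mem_coe.1 ha)).2
    have hb := (Finset.mem_filter.1 (Finset.mem_coe.1 hb)).2
    dsimp only at hab
    rw [← Nat.div_mul_cancel ha, ← Nat.div_mul_cancel hb, hab]
  rw [← Finset.sum_image (f := fun e : ℕ => (1 : ℝ) / e) hinj]
  refine Finset.sum_le_sum_of_subset_of_nonneg ?_ fun _ _ _ => by positivity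
  intro e he
  obtain ⟨d, hd, rfl⟩ := Finset.mem_image.1 he
  have hd' := Nat.mem_divisors.1 (Finset.mem_filter.1 hd).1
  exact Nat.mem_divisors.2 ⟨(Nat.div_dvd_of_dvd (Finset.mem_filter.1 hd).2).trans hd'.1, hd'.2⟩

-- Write `log d` as a sum of the von Mangoldt function over `m ∣ d` and sum over the multiples of
-- `m` first.
open ArithmeticFunction in
theorem sum_divisors_log_div_le (r : ℕ) :
    ∑ d ∈ r.divisors, Real.log d / d
      ≤ (∑ m ∈ r.divisors, vonMangoldt m / m) * ∑ e ∈ r.divisors, (1 : ℝ) / e := by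
  have h1 : ∀ d ∈ r.divisors, Real.log d / d
      = ∑ m ∈ r.divisors, if m ∣ d then vonMangoldt m * (1 / (d : ℝ)) else 0 := by
    intro d hd
    have hd' := Nat.mem_divisors.1 hd
    have hd0 : d ≠ 0 := (Nat.pos_of_mem_divisors hd).ne'
    rw [← Finset.sum_filter, ← Finset.sum_mul, ← vonMangoldt_sum, div_eq_mul_one_div]
    congr 1
    refine Finset.sum_congr ?_ fun _ _ => rfl
    ext m
    simp only [Finset.mem_filter, Nat.mem_divisors]
    exact ⟨fun h => ⟨⟨h.1.trans hd'.1, hd'.2⟩, h.1⟩, fun h => ⟨h.2, hd0⟩⟩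
  rw [Finset.sum_congr rfl h1, Finset.sum_comm, Finset.sum_mul]
  refine Finset.sum_le_sum fun m hm => ?_
  rw [← Finset.sum_filter, ← Finset.mul_sum]
  calc _ ≤ vonMangoldt m * (1 / m * ∑ e ∈ r.divisors, (1 : ℝ) / e) :=
        mul_le_mul_of_nonneg_left (sum_divisors_filter_dvd_inv_le r m hm) vonMangoldt_nonneg
    _ = _ := by ring

-- A self-improving bound. Divisors above `exp (2 V)` have `log d ≥ 2 V`, so by
-- `sum_divisors_log_div_le` they carry at most half of the sum; the rest is at most a harmonic sum,
-- of size `1 + 2 V`.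
open ArithmeticFunction in
theorem sum_divisors_inv_le (r : ℕ) (V : ℝ) (hV0 : 0 < V)
    (hV : ∑ m ∈ r.divisors, vonMangoldt m / m ≤ V) :
    ∑ d ∈ r.divisors, (1 : ℝ) / d ≤ 2 + 4 * V := by
  set S := ∑ d ∈ r.divisors, (1 : ℝ) / d with hS
  have hS0 : 0 ≤ S := Finset.sum_nonneg fun _ _ => by positivity
  have hlog : ∑ d ∈ r.divisors, Real.log d / d ≤ V * S :=
    (sum_divisors_log_div_le r).trans (mul_le_mul_of_nonneg_right hV hS0)
  have hY1 : (1 : ℝ) ≤ Real.exp (2 * V) := Real.one_le_exp (by positivity)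
  have h1 : S ≤ (1 + 2 * V) + (V * S) / (2 * V) := by
    refine (Finset.sum_filter_add_sum_filter_not r.divisors
      (fun d : ℕ => (d : ℝ) ≤ Real.exp (2 * V)) _).symm.trans_le (add_le_add ?_ ?_)
    · have hh := harmonic_floor_le_one_add_log (Real.exp (2 * V)) hY1
      rw [Real.log_exp] at hh
      refine le_trans ?_ hh
      rw [harmonic_eq_sum_Icc]
      push_cast
      simp_rw [one_div]
      refine Finset.sum_le_sum_of_subset_of_nonneg ?_ fun _ _ _ => by positivity
      intro d hd
      rw [Finset.mem_filter] at hd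
      exact Finset.mem_Icc.2 ⟨Nat.pos_of_mem_divisors hd.1, Nat.le_floor hd.2⟩
    · rw [le_div_iff₀ (by positivity)]
      refine le_trans ?_ hlog
      rw [Finset.sum_mul]
      refine le_trans (Finset.sum_le_sum (g := fun d : ℕ => Real.log d / d) ?_)
        (Finset.sum_le_sum_of_subset_of_nonneg (Finset.filter_subset _ _) ?_)
      · intro d hd
        have hd' := not_le.1 (Finset.mem_filter.1 hd).2
        have : 2 * V ≤ Real.log d := by
          rw [Real.le_log_iff_exp_le ((Real.exp_pos _).trans hd')]
          exact hd'.le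
        rw [one_div, inv_mul_eq_div]
        gcongr
      · intro d _ _
        exact div_nonneg (Real.log_natCast_nonneg d) (Nat.cast_nonneg _)
  rw [show V * S / (2 * V) = S / 2 by field_simp] at h1
  linarith

/-- An explicit bound for a weighted sum over divisors. -/
theorem sum_divisors_one_add_log_div_le (r : ℕ) :
    ∑ d ∈ r.divisors, (1 + Real.log d) / d ≤ 4 * (8 + Real.log (Real.log r + 1)) ^ 2 := by
  have hlr : 0 ≤ Real.log r := Real.log_natCast_nonneg r
  set Z := ⌊Real.log r⌋₊ + 1 with hZ
  have hZ1 : Real.log r ≤ Z := by rw [hZ]; push_cast; exact (Nat.lt_floor_add_one _).le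
  have hZ2 : (Z : ℝ) ≤ Real.log r + 1 := by
    rw [hZ]; push_cast; linarith [Nat.floor_le hlr]
  have hZ0 : (0 : ℝ) < Z := by rw [hZ]; positivity
  have h0 : 0 ≤ Real.log (Real.log r + 1) := Real.log_nonneg (by linarith)
  set V := 7 + Real.log (Real.log r + 1) with hVdef
  have hV : ∑ m ∈ r.divisors, ArithmeticFunction.vonMangoldt m / m ≤ V := by
    refine (sum_divisors_vonMangoldt_div_le r Z (by omega)).trans ?_
    have h1 : Real.log r / Z ≤ 1 := (div_le_one hZ0).2 hZ1
    have h2 : Real.log Z ≤ Real.log (Real.log r + 1) := Real.log_le_log hZ0 hZ2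
    linarith
  have hS := sum_divisors_inv_le r V (by linarith) hV
  have hS0 : 0 ≤ ∑ d ∈ r.divisors, (1 : ℝ) / d := Finset.sum_nonneg fun _ _ => by positivity
  have hL := (sum_divisors_log_div_le r).trans (mul_le_mul_of_nonneg_right hV hS0)
  have : ∑ d ∈ r.divisors, (1 + Real.log d) / d
      = ∑ d ∈ r.divisors, (1 : ℝ) / d + ∑ d ∈ r.divisors, Real.log d / d := by
    rw [← Finset.sum_add_distrib]
    exact Finset.sum_congr rfl fun d _ => by ring
  rw [this]
  nlinarith

/-- Split the prime factors at `P`. There are at most `P` small ones, each with exponent at most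
`log₂ n`. For a large prime, `log (a + 1) ≤ a log 2 ≤ (log 2 / log P) a log p`, and the `a log p`
add up to at most `log n`. -/
theorem log_card_divisors_le (n P : ℕ) (hn : n ≠ 0) (hP : 2 ≤ P) :
    Real.log n.divisors.card ≤ P * Real.log (Nat.log 2 n + 1) + Real.log 2 * Real.log n / Real.log P := by
  have hP' : (2 : ℝ) ≤ P := by exact_mod_cast hP
  have hlP : 0 < Real.log P := Real.log_pos (by linarith)
  have hl2 : 0 < Real.log 2 := Real.log_pos (by norm_num)
  have hc : 0 ≤ Real.log (Nat.log 2 n + 1) := Real.log_nonneg (by simp)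
  rw [Nat.card_divisors hn, Nat.cast_prod, Real.log_prod (fun p _ => by positivity)]
  have h1 : ∀ p ∈ n.primeFactors, Real.log ((n.factorization p + 1 : ℕ) : ℝ)
      ≤ (if p < P then Real.log (Nat.log 2 n + 1) else 0)
        + Real.log 2 / Real.log P * (n.factorization p * Real.log p) := by
    intro p hp
    have hpp := Nat.prime_of_mem_primeFactors hp
    have hlp : 0 ≤ Real.log p := Real.log_natCast_nonneg p
    split_ifs with h
    · have : n.factorization p ≤ Nat.log 2 n := by
        apply Nat.le_log_of_pow_le (by norm_num)
        calc 2 ^ n.factorization p ≤ p ^ n.factorization p := Nat.pow_le_pow_left hpp.two_le _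
          _ ≤ n := Nat.ordProj_le p hn
      have h3 : Real.log ((n.factorization p + 1 : ℕ) : ℝ) ≤ Real.log (Nat.log 2 n + 1) := by
        apply Real.log_le_log (by positivity)
        exact_mod_cast Nat.succ_le_succ this
      have : 0 ≤ Real.log 2 / Real.log P * (n.factorization p * Real.log p) := by positivity
      linarith
    · rw [zero_add]
      have h4 : Real.log ((n.factorization p + 1 : ℕ) : ℝ) ≤ n.factorization p * Real.log 2 := by
        rw [← Real.log_pow]
        apply Real.log_le_log (by positivity)
        exact_mod_cast (Nat.lt_two_pow_self (n := n.factorization p))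
      have h5 : Real.log P ≤ Real.log p :=
        Real.log_le_log (by linarith) (by exact_mod_cast not_lt.1 h)
      refine h4.trans ?_
      rw [div_mul_eq_mul_div, le_div_iff₀ hlP]
      calc _ = (n.factorization p * Real.log 2) * Real.log P := by ring
        _ ≤ (n.factorization p * Real.log 2) * Real.log p := by gcongr
        _ = _ := by ring
  refine (Finset.sum_le_sum h1).trans ?_
  rw [Finset.sum_add_distrib, ← Finset.mul_sum]
  have h2 : ∑ p ∈ n.primeFactors, (n.factorization p : ℝ) * Real.log p = Real.log n := by
    rw [Real.log_nat_eq_sum_factorization n]; rfl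
  rw [h2, ← Finset.sum_filter, Finset.sum_const, nsmul_eq_mul]
  apply add_le_add
  · gcongr
    calc (n.primeFactors.filter (fun p => p < P)).card ≤ (Finset.range P).card :=
          Finset.card_le_card fun p hp => Finset.mem_range.2 (Finset.mem_filter.1 hp).2
      _ = P := Finset.card_range P
  · apply le_of_eq; ring

/-! ### The row sum: overlaps with a fixed `r`, by greatest common divisor and dyadic size. -/

theorem distInt_neg (x : ℝ) : distInt (-x) = distInt x := by
  simp only [distInt_eq_norm, AddCircle.coe_neg, norm_neg]

/-- Each block of `T` consecutive integers starting at a multiple of `T` contains at most one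
element, and the block of `0` contains none; hence there is no additive `1`. -/
theorem card_mul_le_of_gap (X : Finset ℕ) (R T : ℕ) (hT : 0 < T) (h1 : ∀ h ∈ X, T ≤ h ∧ h ≤ R)
    (h2 : ∀ h ∈ X, ∀ h' ∈ X, h < h' → T ≤ h' - h) : X.card * T ≤ R := by
  have hinj : Set.InjOn (fun h => h / T) (X : Set ℕ) := by
    have key : ∀ a ∈ X, ∀ b ∈ X, a < b → a / T ≠ b / T := by
      intro a ha b hb hab h
      have := h2 a ha b hb hab
      have h3 : a / T + 1 ≤ b / T := by
        rw [← Nat.add_div_right a hT]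
        exact Nat.div_le_div_right (by omega)
      omega
    intro a ha b hb hab
    rcases lt_trichotomy a b with h | h | h
    · exact absurd hab (key a ha b hb h)
    · exact h
    · exact absurd hab.symm (key b hb a ha h)
  have hsub : X.image (fun h => h / T) ⊆ Finset.Icc 1 (R / T) := by
    intro m hm
    obtain ⟨h, hh, rfl⟩ := Finset.mem_image.1 hm
    exact Finset.mem_Icc.2 ⟨(Nat.one_le_div_iff hT).2 (h1 h hh).1, Nat.div_le_div_right (h1 h hh).2⟩
  have := Finset.card_le_card hsub
  rw [Finset.card_image_of_injOn hinj, Nat.card_Icc, Nat.add_sub_cancel] at this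
  exact (Nat.mul_le_mul_right T this).trans (Nat.div_mul_le_self R T)

/-- Contribution to the overlaps with a fixed `r = s d` of the `q = p d` in a dyadic block for which
`‖q β - γ'‖` also lies in a dyadic block. -/
theorem sum_dyadic_class_le (f : ℕ → ℝ) (γ β γ' A Λ ℓ Y : ℝ) (s d i j : ℕ) (hd : 0 < d) (hA : 0 < A)
    (hΛ : 0 < Λ) (hY : 1 ≤ Y) (hℓY : ℓ ^ 2 ≤ Y) (hℓ : 1 ≤ ℓ) (hdY : d ≤ Y)
    (hdio : ∀ k₁ k₂ : ℤ, ((|k₁| : ℤ) : ℝ) ≤ Y ^ 2 → ((|k₂| : ℤ) : ℝ) ≤ Y ^ 2 → (k₁, k₂) ≠ (0, 0) →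
      Y ^ 7 / (s * d : ℕ) ≤ distInt (k₁ * γ + k₂ * β))
    (hfs : 0 < f (s * d)) (X : Finset ℕ) (hX0 : ∀ p ∈ X, 0 < p)
    (hflow : ∀ p ∈ X, 1 / ((p * d : ℕ) * ℓ ^ 2) ≤ f (p * d))
    (hi1 : ∀ p ∈ X, (2 : ℝ) ^ i * p ≤ s) (hi2 : ∀ p ∈ X, (s : ℝ) ≤ 2 ^ (i + 1) * p)
    (hiY : (2 : ℝ) ^ i ≤ Y ^ 3) (hjY : (2 : ℝ) ^ j ≤ Y)
    (hj1 : ∀ p ∈ X, distInt ((p * d : ℕ) * β - γ') ≤ 1 / 2 ^ j)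
    (hj2 : ∀ p ∈ X, 1 / 2 ^ (j + 1) ≤ distInt ((p * d : ℕ) * β - γ'))
    (hfup : ∀ p ∈ X, f (p * d) ≤ A / (distInt ((p * d : ℕ) * β - γ') * (p * d : ℕ) * Λ))
    (hclose : ∀ p ∈ X, distInt (p * γ - s * γ)
      ≤ 2 * max (f (p * d) / (p * d : ℕ)) (f (s * d) / (s * d : ℕ)) * (p * s * d)) :
    ∑ p ∈ X, d * min (f (p * d) / (p * d : ℕ)) (f (s * d) / (s * d : ℕ))
      ≤ 18560 * A * f (s * d) / (d * Λ) := by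
  have hd' : (0 : ℝ) < d := by exact_mod_cast hd
  rcases X.eq_empty_or_nonempty with rfl | ⟨p₀, hp₀⟩
  · simp; positivity
  have hp₀' : (1 : ℝ) ≤ p₀ := by exact_mod_cast hX0 p₀ hp₀
  have hs : (2 : ℝ) ^ i ≤ s := le_trans (le_mul_of_one_le_right (by positivity) hp₀') (hi1 p₀ hp₀)
  have hs0 : (0 : ℝ) < s := lt_of_lt_of_le (by positivity) hs
  push_cast at hdio hflow hj1 hj2 hfup hclose ⊢
  set g := f (s * d) / ((s : ℝ) * d) with hg
  have hg0 : 0 < g := by positivity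
  -- A bound for `f (p d) / (p d)` valid on the whole class, from `1 / ‖p d β - γ'‖ ≤ 2 ^ (j + 1)`
  -- and `s ≤ 2 ^ (i + 1) p`.
  set G := 8 * A * 2 ^ j * 4 ^ i / ((s * d : ℝ) ^ 2 * Λ) with hG
  have hG0 : 0 < G := by positivity
  set M := (s : ℝ) / 2 ^ i with hM
  have hM0 : 0 < M := by positivity
  have hM1 : 1 ≤ M := by rw [hM, le_div_iff₀ (by positivity), one_mul]; exact hs
  set η := 2 * max G g * (s * M * d) with hη
  have hη0 : 0 < η := by positivity
  have h4 : (4 : ℝ) ^ i = 2 ^ i * 2 ^ i := by rw [← mul_pow]; norm_num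
  have hfG : ∀ p ∈ X, f (p * d) / (p * d) ≤ G := by
    intro p hp
    have hp0 : (0 : ℝ) < p := by exact_mod_cast hX0 p hp
    have hdist : 0 < distInt (p * d * β - γ') := lt_of_lt_of_le (by positivity) (hj2 p hp)
    have e1 : f (p * d) ≤ A * 2 ^ (j + 1) / (p * d * Λ) := by
      refine (hfup p hp).trans ?_
      rw [div_le_div_iff₀ (by positivity) (by positivity)]
      have := hj2 p hp
      rw [div_le_iff₀ (by positivity)] at this
      calc A * (p * d * Λ) = A * (p * d * Λ) * 1 := by ring
        _ ≤ A * (p * d * Λ) * (distInt (p * d * β - γ') * 2 ^ (j + 1)) := by gcongr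
        _ = _ := by ring
    have e2 : (s : ℝ) ^ 2 ≤ (2 ^ (i + 1) * p) ^ 2 := by
      have := hi2 p hp
      gcongr
    rw [hG, le_div_iff₀ (by positivity), div_mul_eq_mul_div, div_le_iff₀ (by positivity)]
    rw [le_div_iff₀ (by positivity)] at e1
    calc f (p * d) * ((s * d) ^ 2 * Λ) = f (p * d) * d ^ 2 * Λ * s ^ 2 := by ring
      _ ≤ f (p * d) * d ^ 2 * Λ * (2 ^ (i + 1) * p) ^ 2 := by
          have : 0 ≤ f (p * d) := le_trans (by positivity) (hflow p hp)
          gcongr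
      _ = (f (p * d) * (p * d * Λ)) * (4 * (2 ^ i * 2 ^ i) * p * d) := by ring
      _ ≤ (A * 2 ^ (j + 1)) * (4 * (2 ^ i * 2 ^ i) * p * d) := by gcongr
      _ = _ := by rw [h4]; ring
  -- The lower bound on the radii keeps the box from being too thin, so frequencies up to `Y ^ 2`
  -- suffice in the `γ` direction.
  have hηlow : 1 ≤ η * (d * ℓ ^ 2) := by
    have e1 := hflow p₀ hp₀
    have e2 := hfG p₀ hp₀
    have e3 : 1 / (p₀ * d * ℓ ^ 2) / (p₀ * d) ≤ G := le_trans (by gcongr) e2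
    have e4 : (p₀ : ℝ) ≤ M := by
      rw [hM, le_div_iff₀ (by positivity)]; linarith [hi1 p₀ hp₀]
    have e5 : M ≤ s := by
      rw [hM, div_le_iff₀ (by positivity)]
      exact le_mul_of_one_le_right hs0.le (one_le_pow₀ (by norm_num))
    calc (1 : ℝ) ≤ 2 * (1 / (p₀ * d * ℓ ^ 2) / (p₀ * d)) * (p₀ * p₀ * d) * (d * ℓ ^ 2) := by
          field_simp; norm_num
      _ ≤ 2 * max G g * (s * M * d) * (d * ℓ ^ 2) := by
          gcongr
          · exact e3.trans (le_max_left _ _)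
          · exact_mod_cast e4.trans e5
      _ = _ := by rw [hη]
  have hη1 : 1 / η ≤ Y ^ 2 := by
    rw [div_le_iff₀ hη0]
    calc (1 : ℝ) ≤ η * (d * ℓ ^ 2) := hηlow
      _ ≤ η * (Y * Y) := by gcongr
      _ = _ := by ring
  -- The counted points are `p (γ, d β)`, so a frequency `k₂` for the second coordinate becomes `k₂
  -- d` for `β`; `d ≤ Y` and `2 ^ j ≤ Y` keep it below `Y ^ 2`.
  have hcard := card_box_le (⌊M⌋₊ + 1) γ (d * β) (s * γ) γ' η (1 / 2 ^ j) (Y ^ 7 / (s * d)) hη0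
    (by positivity) (by positivity) (by
      intro k₁ k₂ h1 h2 hne
      have h3 : ((|k₂ * d| : ℤ) : ℝ) ≤ Y ^ 2 := by
        rw [abs_mul, Int.cast_mul, Nat.abs_cast, Int.cast_natCast]
        rw [one_div_one_div] at h2
        calc ((|k₂| : ℤ) : ℝ) * d ≤ Y * Y := by gcongr; exact h2.trans hjY
          _ = Y ^ 2 := by ring
      have := hdio k₁ (k₂ * d) (by rw [← Int.cast_abs]; exact h1.trans hη1)
        (by rw [← Int.cast_abs]; exact h3) (by
        intro h
        apply hne
        rw [Prod.mk.injEq] at h ⊢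
        refine ⟨h.1, ?_⟩
        rcases mul_eq_zero.1 h.2 with h | h
        · exact h
        · exact absurd h (by exact_mod_cast hd.ne'))
      push_cast at this
      rwa [← mul_assoc]) X (by
      intro p hp
      rw [Finset.mem_range, Nat.lt_succ_iff]
      apply Nat.le_floor
      rw [hM, le_div_iff₀ (by positivity)]; linarith [hi1 p hp]) (by
      intro p hp
      refine (hclose p hp).trans ?_
      rw [hη]
      have e1 : (p : ℝ) ≤ M := by
        rw [hM, le_div_iff₀ (by positivity)]; linarith [hi1 p hp]
      have e2 := hfG p hp
      have e3 : (p * s * d : ℝ) ≤ s * M * d := by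
        rw [mul_comm (p : ℝ)]; gcongr
      have e4 : max (f (p * d) / (p * d)) g ≤ max G g := max_le_max_right _ e2
      gcongr) (by
      intro p hp
      rw [← mul_assoc]
      exact hj1 p hp)
  have hMfl : ((⌊M⌋₊ + 1 : ℕ) : ℝ) ≤ 2 * M := by
    push_cast
    linarith [Nat.floor_le hM0.le]
  have hcard2 : (X.card : ℝ) ≤ 1160 * (M * η * (1 / 2 ^ j)) := by
    -- The error of the box count is dominated by its main term because `2 ^ i`, `2 ^ j`, `d` and `1
    -- / η` are at most `Y ^ 3`, `Y`, `Y` and `Y ^ 2`: this is the source of the exponent `7`.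
    have e1 : 8 / (Y ^ 7 / (s * d)) ≤ 8 * (M * η * (1 / 2 ^ j)) := by
      have e2 : (s : ℝ) * d / Y ^ 7 ≤ M * η * (1 / 2 ^ j) := by
        rw [div_le_iff₀ (by positivity), hM]
        have e3 : 2 ^ i * 2 ^ j * d * (1 / η) ≤ Y ^ 3 * Y * Y * Y ^ 2 := by gcongr
        have e4 : s * d * η * (2 ^ i * 2 ^ j * d * (1 / η)) ≤ s * d * η * (Y ^ 3 * Y * Y * Y ^ 2) := by
          gcongr
        have e5 : s * d * η * (2 ^ i * 2 ^ j * d * (1 / η)) = s * d * (2 ^ i * 2 ^ j * d) := by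
          field_simp
        rw [e5] at e4
        have e6 : (s : ℝ) / 2 ^ i * η * (1 / 2 ^ j) * Y ^ 7 = s * η * Y ^ 7 / (2 ^ i * 2 ^ j) := by
          field_simp
        rw [e6, le_div_iff₀ (by positivity)]
        refine le_of_mul_le_mul_right ?_ hd'
        linear_combination e4
      calc 8 / (Y ^ 7 / (s * d)) = 8 * (s * d / Y ^ 7) := by rw [div_div_eq_mul_div]; ring
        _ ≤ _ := by gcongr
    have e2 : 576 * ((⌊M⌋₊ + 1 : ℕ) : ℝ) * η * (1 / 2 ^ j) ≤ 576 * (2 * M) * η * (1 / 2 ^ j) := by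
      gcongr
    linarith
  calc ∑ p ∈ X, d * min (f (p * d) / (p * d)) g ≤ ∑ p ∈ X, d * min G g := by
        apply Finset.sum_le_sum
        intro p hp
        have := hfG p hp
        gcongr
    _ = X.card * (d * min G g) := by rw [Finset.sum_const, nsmul_eq_mul]
    _ ≤ 1160 * (M * η * (1 / 2 ^ j)) * (d * min G g) := by
        have : 0 ≤ min G g := le_min hG0.le hg0.le
        gcongr
    -- The count is proportional to the maximum and each summand to the minimum. Their product is `G
    -- g`, and all powers of `2 ^ i` and `2 ^ j` then cancel, so every dyadic class receives the
    -- same bound.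
    _ = 2320 * (min G g * max G g) * (M ^ 2 * s * d ^ 2 / 2 ^ j) := by rw [hη]; ring
    _ = 2320 * (G * g) * (M ^ 2 * s * d ^ 2 / 2 ^ j) := by rw [min_mul_max]
    _ = 18560 * A * f (s * d) / (d * Λ) := by
        rw [hG, hg, hM, h4]
        field_simp
        norm_num

/-- The bounds on the radii `f q`, `q ≤ r`, and on `γ`, `β`, `γ'` which enter the estimate for the
overlaps with a fixed `r`. -/
structure RowBounds (S : Set ℕ) (f : ℕ → ℝ) (γ β γ' A Λ ℓ Y Z : ℝ) (r : ℕ) : Prop where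
  A_pos : 0 < A
  one_le_Λ : 1 ≤ Λ
  one_le_ℓ : 1 ≤ ℓ
  one_le_Z : 1 ≤ Z
  sq_le_Y : ℓ ^ 2 ≤ Y
  Z_le_Y : Z ≤ Y
  Y_le : Y ≤ r
  mem : r ∈ S
  pos : ∀ q ∈ S, 0 < q
  dio : ∀ k₁ k₂ : ℤ, ((|k₁| : ℤ) : ℝ) ≤ Y ^ 2 → ((|k₂| : ℤ) : ℝ) ≤ Y ^ 2 → (k₁, k₂) ≠ (0, 0) →
    Y ^ 7 / r ≤ distInt (k₁ * γ + k₂ * β)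
  low : ∀ q ∈ S, q ≤ r → 1 / (q * ℓ ^ 2) ≤ f q
  dist_ge : ∀ q ∈ S, q ≤ r → (r : ℝ) ≤ Y ^ 3 * q → 1 / Z ≤ distInt (q * β - γ')
  up : ∀ q ∈ S, q ≤ r → (r : ℝ) ≤ Y ^ 3 * q → f q ≤ A / (distInt (q * β - γ') * q * Λ)

namespace RowBounds

variable {S : Set ℕ} {f : ℕ → ℝ} {γ β γ' A Λ ℓ Y Z : ℝ}

theorem f_pos {r q : ℕ} (h : RowBounds S f γ β γ' A Λ ℓ Y Z r) (hq : q ∈ S) (hqr : q ≤ r) :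
    0 < f q := by
  have h1 : (0 : ℝ) < q := by exact_mod_cast h.pos q hq
  have h2 := h.one_le_ℓ
  exact lt_of_lt_of_le (by positivity) (h.low q hq hqr)

/-- Every dyadic class costs the same, so only the number of classes matters. The scale of `s / p`
is limited by `hXK`, and that of `1 / ‖p d β - γ'‖` by `Z ≤ Y ≤ s d`. -/
theorem sum_small_gcd_le {s d : ℕ} (h : RowBounds S f γ β γ' A Λ ℓ Y Z (s * d)) {K : ℝ}
    (hK1 : 1 ≤ K) (hKY : K ≤ Y) (hd : 0 < d) (hdY : d ≤ Y) (X : Finset ℕ)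
    (hXS : ∀ p ∈ X, p * d ∈ S) (hXs : ∀ p ∈ X, p ≤ s) (hXK : ∀ p ∈ X, (s : ℝ) ≤ K * d * ℓ ^ 2 * p)
    (hclose : ∀ p ∈ X, distInt (p * γ - s * γ)
      ≤ 2 * max (f (p * d) / (p * d : ℕ)) (f (s * d) / (s * d : ℕ)) * (p * s * d)) :
    ∑ p ∈ X, d * min (f (p * d) / (p * d : ℕ)) (f (s * d) / (s * d : ℕ))
      ≤ (Real.logb 2 (K * d * ℓ ^ 2) + 1) * (Real.logb 2 (s * d : ℕ) + 1)
        * (18560 * A * f (s * d) / (d * Λ)) := by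
  have hY : 1 ≤ Y := h.one_le_Z.trans h.Z_le_Y
  have hd1 : (1 : ℝ) ≤ d := by exact_mod_cast hd
  have hℓ := h.one_le_ℓ
  have hsd0 : 0 < s * d := h.pos _ h.mem
  have hX0 : ∀ p ∈ X, 0 < p := fun p hp => Nat.pos_of_mul_pos_right (h.pos _ (hXS p hp))
  have hXr : ∀ p ∈ X, p * d ≤ s * d := fun p hp => Nat.mul_le_mul_right d (hXs p hp)
  have hKd1 : 1 ≤ K * d * ℓ ^ 2 :=
    one_le_mul_of_one_le_of_one_le (one_le_mul_of_one_le_of_one_le hK1 hd1) (one_le_pow₀ hℓ)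
  have hKdY : K * d * ℓ ^ 2 ≤ Y ^ 3 := by
    calc K * d * ℓ ^ 2 ≤ Y * Y * Y := by gcongr; exact h.sq_le_Y
      _ = Y ^ 3 := by ring
  have hXY : ∀ p ∈ X, ((s * d : ℕ) : ℝ) ≤ Y ^ 3 * (p * d : ℕ) := by
    intro p hp
    push_cast
    rw [← mul_assoc]
    gcongr
    exact (hXK p hp).trans (by gcongr)
  have hdist := fun p hp => h.dist_ge _ (hXS p hp) (hXr p hp) (hXY p hp)
  have hdist0 : ∀ p ∈ X, 0 < distInt ((p * d : ℕ) * β - γ') := fun p hp =>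
    lt_of_lt_of_le (by have := h.one_le_Z; positivity) (hdist p hp)
  set ι : ℕ → ℕ := fun p => Nat.log 2 (s / p) with hι
  set κ : ℕ → ℕ := fun p => Nat.log 2 ⌊1 / distInt ((p * d : ℕ) * β - γ')⌋₊ with hκ
  have hι1 : ∀ p ∈ X, (2 : ℝ) ^ ι p * p ≤ s := by
    intro p hp
    have h1 : 2 ^ ι p ≤ s / p :=
      Nat.pow_log_le_self 2 (Nat.div_pos (hXs p hp) (hX0 p hp)).ne'
    exact_mod_cast (Nat.mul_le_mul_right p h1).trans (Nat.div_mul_le_self s p)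
  have hι2 : ∀ p ∈ X, (s : ℝ) ≤ 2 ^ (ι p + 1) * p := by
    intro p hp
    have h1 : s / p < 2 ^ (ι p + 1) := Nat.lt_pow_succ_log_self (by norm_num) _
    have h2 : s < p * (s / p + 1) := Nat.lt_mul_div_succ s (hX0 p hp)
    have h3 : s ≤ 2 ^ (ι p + 1) * p := by
      refine h2.le.trans ?_
      rw [mul_comm p]
      exact Nat.mul_le_mul_right p h1
    exact_mod_cast h3
  have hι3 : ∀ p ∈ X, (2 : ℝ) ^ ι p ≤ K * d * ℓ ^ 2 := by
    intro p hp
    have hp0 : (0 : ℝ) < p := by exact_mod_cast hX0 p hp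
    exact le_of_mul_le_mul_right ((hι1 p hp).trans (hXK p hp)) hp0
  have hfl : ∀ p ∈ X, ⌊1 / distInt ((p * d : ℕ) * β - γ')⌋₊ ≠ 0 := by
    intro p hp
    refine (Nat.floor_pos.2 ?_).ne'
    rw [le_div_iff₀ (hdist0 p hp)]
    linarith [distInt_le_half ((p * d : ℕ) * β - γ')]
  have hκ1 : ∀ p ∈ X, (2 : ℝ) ^ κ p ≤ 1 / distInt ((p * d : ℕ) * β - γ') := by
    intro p hp
    have h1 : 2 ^ κ p ≤ ⌊1 / distInt ((p * d : ℕ) * β - γ')⌋₊ := Nat.pow_log_le_self 2 (hfl p hp)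
    have h2 := Nat.floor_le (one_div_pos.2 (hdist0 p hp)).le
    exact le_trans (by exact_mod_cast h1) h2
  have hκ2 : ∀ p ∈ X, 1 / distInt ((p * d : ℕ) * β - γ') ≤ (2 : ℝ) ^ (κ p + 1) := by
    intro p hp
    have h1 : ⌊1 / distInt ((p * d : ℕ) * β - γ')⌋₊ < 2 ^ (κ p + 1) :=
      Nat.lt_pow_succ_log_self (by norm_num) _
    have h2 := (Nat.lt_floor_add_one (1 / distInt ((p * d : ℕ) * β - γ'))).le
    have h3 : ((⌊1 / distInt ((p * d : ℕ) * β - γ')⌋₊ + 1 : ℕ) : ℝ) ≤ ((2 ^ (κ p + 1) : ℕ) : ℝ) :=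
      Nat.cast_le.2 h1
    push_cast at h3
    push_cast at h2 ⊢
    linarith
  have hκ3 : ∀ p ∈ X, (2 : ℝ) ^ κ p ≤ Z := by
    intro p hp
    refine (hκ1 p hp).trans ?_
    rw [one_div_le (hdist0 p hp) (by linarith [h.one_le_Z])]
    exact hdist p hp
  have hlog : ∀ (n : ℕ) (x : ℝ), (2 : ℝ) ^ n ≤ x → n ≤ ⌊Real.logb 2 x⌋₊ := by
    intro n x hx
    apply Nat.le_floor
    rw [Real.le_logb_iff_rpow_le (by norm_num) (lt_of_lt_of_le (by positivity) hx)]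
    exact_mod_cast hx
  set I := ⌊Real.logb 2 (K * d * ℓ ^ 2)⌋₊ with hI
  set J := ⌊Real.logb 2 (s * d : ℕ)⌋₊ with hJ
  have hmaps : ∀ p ∈ X, (ι p, κ p) ∈ Finset.range (I + 1) ×ˢ Finset.range (J + 1) := by
    intro p hp
    rw [Finset.mem_product, Finset.mem_range, Finset.mem_range, Nat.lt_succ_iff, Nat.lt_succ_iff]
    exact ⟨hlog _ _ (hι3 p hp), hlog _ _ ((hκ3 p hp).trans (h.Z_le_Y.trans h.Y_le))⟩
  have hB : 0 ≤ 18560 * A * f (s * d) / (d * Λ) := by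
    have h1 := h.A_pos
    have h2 := h.one_le_Λ
    have h3 := (h.f_pos h.mem le_rfl).le
    positivity
  rw [← Finset.sum_fiberwise_of_maps_to hmaps]
  refine (Finset.sum_le_card_nsmul _ _ (18560 * A * f (s * d) / (d * Λ)) ?_).trans ?_
  · rintro ⟨i, j⟩ _
    have hmem : ∀ p ∈ X.filter (fun p => (ι p, κ p) = (i, j)), p ∈ X ∧ ι p = i ∧ κ p = j := by
      intro p hp
      rw [Finset.mem_filter, Prod.mk.injEq] at hp
      exact hp
    rcases (X.filter (fun p => (ι p, κ p) = (i, j))).eq_empty_or_nonempty with he | ⟨p₀, hp₀⟩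
    · rw [he, Finset.sum_empty]; exact hB
    obtain ⟨hp₁, rfl, rfl⟩ := hmem p₀ hp₀
    refine sum_dyadic_class_le f γ β γ' A Λ ℓ Y s d (ι p₀) (κ p₀) hd h.A_pos
      (by linarith [h.one_le_Λ]) hY h.sq_le_Y hℓ hdY h.dio (h.f_pos h.mem le_rfl) _
      (fun p hp => hX0 p (hmem p hp).1) (fun p hp => h.low _ (hXS p (hmem p hp).1) (hXr p (hmem p hp).1))
      ?_ ?_ ((hι3 p₀ hp₁).trans hKdY) ((hκ3 p₀ hp₁).trans h.Z_le_Y) ?_ ?_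
      (fun p hp => h.up _ (hXS p (hmem p hp).1) (hXr p (hmem p hp).1) (hXY p (hmem p hp).1))
      (fun p hp => hclose p (hmem p hp).1)
    · intro p hp
      obtain ⟨hp, h1, h2⟩ := hmem p hp
      rw [← h1]; exact hι1 p hp
    · intro p hp
      obtain ⟨hp, h1, h2⟩ := hmem p hp
      rw [← h1]; exact hι2 p hp
    · intro p hp
      obtain ⟨hp, h1, h2⟩ := hmem p hp
      rw [← h2, le_one_div (hdist0 p hp) (by positivity)]; exact hκ1 p hp
    · intro p hp
      obtain ⟨hp, h1, h2⟩ := hmem p hp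
      rw [← h2, one_div_le (by positivity) (hdist0 p hp)]; exact hκ2 p hp
  · rw [nsmul_eq_mul, Finset.card_product, Finset.card_range, Finset.card_range]
    push_cast
    have e1 : (I : ℝ) ≤ Real.logb 2 (K * d * ℓ ^ 2) :=
      Nat.floor_le (Real.logb_nonneg (by norm_num) hKd1)
    have e2 : (J : ℝ) ≤ Real.logb 2 (s * d : ℕ) :=
      Nat.floor_le (Real.logb_nonneg (by norm_num) (by exact_mod_cast hsd0))
    push_cast at e2
    have e0 : (0 : ℝ) ≤ I := Nat.cast_nonneg _
    have e3 : 0 ≤ Real.logb 2 (K * d * ℓ ^ 2) + 1 := by linarith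
    gcongr

/-- Each summand is at most `f (s d) / s`, so it is enough to count. At most `s / Z` values have `p
< s / Z`. For the others the radii are so small, because `d > Y`, that `p γ` is within `2 A Z² / Y`
of `s γ`; two such `p`, or one of them and `s`, cannot differ by `T` or less by `hγ`, which leaves
at most `s / T` values. -/
theorem sum_large_gcd_le {s d T : ℕ} (h : RowBounds S f γ β γ' A Λ ℓ Y Z (s * d)) (hT : 0 < T)
    (hγ : ∀ k : ℕ, 0 < k → k ≤ T → 4 * A * Z ^ 2 / Y < distInt (k * γ))
    (hd : 0 < d) (hdY : Y < d) (X : Finset ℕ)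
    (hXS : ∀ p ∈ X, p * d ∈ S) (hXs : ∀ p ∈ X, p < s)
    (hclose : ∀ p ∈ X, distInt (p * γ - s * γ)
      ≤ 2 * max (f (p * d) / (p * d : ℕ)) (f (s * d) / (s * d : ℕ)) * (p * s * d)) :
    ∑ p ∈ X, d * min (f (p * d) / (p * d : ℕ)) (f (s * d) / (s * d : ℕ))
      ≤ f (s * d) * (1 / Z + 1 / T) := by
  classical
  have hZ := h.one_le_Z
  have hY : 1 ≤ Y := hZ.trans h.Z_le_Y
  have hA := h.A_pos
  have hd' : (0 : ℝ) < d := by exact_mod_cast hd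
  have hT' : (0 : ℝ) < T := by exact_mod_cast hT
  have hsd0 : 0 < s * d := h.pos _ h.mem
  have hs0 : (0 : ℝ) < s := by exact_mod_cast Nat.pos_of_mul_pos_right hsd0
  have hfr := h.f_pos h.mem le_rfl
  have hX0 : ∀ p ∈ X, 0 < p := fun p hp => Nat.pos_of_mul_pos_right (h.pos _ (hXS p hp))
  have hXr : ∀ p ∈ X, p * d ≤ s * d := fun p hp => Nat.mul_le_mul_right d (hXs p hp).le
  have hfup : ∀ q ∈ S, q ≤ s * d → ((s * d : ℕ) : ℝ) ≤ Z * q → f q ≤ A * Z / q := by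
    intro q hq hqr hq2
    have hq0 : (0 : ℝ) < q := by exact_mod_cast h.pos q hq
    have h1 : ((s * d : ℕ) : ℝ) ≤ Y ^ 3 * q := by
      refine hq2.trans ?_
      gcongr
      exact h.Z_le_Y.trans (le_self_pow₀ hY (by norm_num))
    have h2 := h.dist_ge q hq hqr h1
    refine (h.up q hq hqr h1).trans ?_
    have h3 : 1 / Z * q * 1 ≤ distInt (q * β - γ') * q * Λ := by
      have := h.one_le_Λ
      have := distInt_nonneg (q * β - γ')
      gcongr
    calc A / (distInt (q * β - γ') * q * Λ) ≤ A / (1 / Z * q * 1) := by gcongr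
      _ = A * Z / q := by field_simp
  have hsmall : ∀ p ∈ X, (s : ℝ) ≤ Z * p → distInt (p * γ - s * γ) ≤ 2 * A * Z ^ 2 / Y := by
    intro p hp hps
    have hp0 : (0 : ℝ) < p := by exact_mod_cast hX0 p hp
    have hps' : (p : ℝ) ≤ s := by exact_mod_cast (hXs p hp).le
    refine (hclose p hp).trans ?_
    have e1 := hfup (p * d) (hXS p hp) (hXr p hp) (by push_cast; rw [← mul_assoc]; gcongr)
    have e2 := hfup (s * d) h.mem le_rfl (le_mul_of_one_le_left (Nat.cast_nonneg _) hZ)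
    push_cast at e1 e2 ⊢
    have e3 : f (p * d) / (p * d) * (p * s * d) ≤ A * Z ^ 2 / Y := by
      calc f (p * d) / (p * d) * (p * s * d) = f (p * d) * s := by field_simp
        _ ≤ A * Z / (p * d) * (Z * p) := by gcongr
        _ = A * Z ^ 2 / d := by field_simp
        _ ≤ _ := by gcongr
    have e4 : f (s * d) / (s * d) * (p * s * d) ≤ A * Z ^ 2 / Y := by
      calc f (s * d) / (s * d) * (p * s * d) = f (s * d) * p := by field_simp
        _ ≤ A * Z / (s * d) * (Z * s) := by
            gcongr
            exact hps'.trans (le_mul_of_one_le_left hs0.le hZ)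
        _ = A * Z ^ 2 / d := by field_simp
        _ ≤ _ := by gcongr
    have e5 : max (f (p * d) / (p * d)) (f (s * d) / (s * d)) * (p * s * d) ≤ A * Z ^ 2 / Y := by
      rcases max_choice (f (p * d) / (p * d)) (f (s * d) / ((s : ℝ) * d)) with hm | hm <;> rw [hm] <;>
        assumption
    calc _ = 2 * (max (f (p * d) / (p * d)) (f (s * d) / (s * d)) * (p * s * d)) := by ring
      _ ≤ 2 * (A * Z ^ 2 / Y) := by gcongr
      _ = _ := by ring
  have hsplit := Finset.card_filter_add_card_filter_not (s := X) (fun p : ℕ => (s : ℝ) ≤ Z * p)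
  have hc1 : (((X.filter (fun p : ℕ => ¬ (s : ℝ) ≤ Z * p)).card : ℕ) : ℝ) ≤ s / Z := by
    have hsub : X.filter (fun p : ℕ => ¬ (s : ℝ) ≤ Z * p) ⊆ Finset.Icc 1 ⌊(s : ℝ) / Z⌋₊ := by
      intro p hp
      obtain ⟨hp, h1⟩ := Finset.mem_filter.1 hp
      refine Finset.mem_Icc.2 ⟨hX0 p hp, Nat.le_floor ?_⟩
      rw [le_div_iff₀ (by linarith)]
      linarith [not_le.1 h1]
    have := Finset.card_le_card hsub
    rw [Nat.card_Icc, Nat.add_sub_cancel] at this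
    exact le_trans (by exact_mod_cast this) (Nat.floor_le (by positivity))
  have hc2 : (((X.filter (fun p : ℕ => (s : ℝ) ≤ Z * p)).card : ℕ) : ℝ) ≤ s / T := by
    set W := X.filter (fun p : ℕ => (s : ℝ) ≤ Z * p) with hW
    have hWm : ∀ p ∈ W, p < s ∧ distInt (p * γ - s * γ) ≤ 2 * A * Z ^ 2 / Y := fun p hp => by
      obtain ⟨hp, h1⟩ := Finset.mem_filter.1 hp
      exact ⟨hXs p hp, hsmall p hp h1⟩
    have hinj : Set.InjOn (fun p => s - p) (W : Set ℕ) := by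
      intro a ha b hb hab
      have h1 := (hWm a ha).1
      have h2 := (hWm b hb).1
      dsimp only at hab
      omega
    have hhalf : 2 * A * Z ^ 2 / Y ≤ 4 * A * Z ^ 2 / Y := by
      gcongr; norm_num
    -- Passing to the differences `s - p` makes the separation from `s` itself available, as the
    -- lower bound `T` on the elements.
    have hgap := card_mul_le_of_gap (W.image (fun p => s - p)) s T hT (by
      intro k hk
      obtain ⟨p, hp, rfl⟩ := Finset.mem_image.1 hk
      obtain ⟨h1, h2⟩ := hWm p hp
      refine ⟨?_, by omega⟩
      by_contra! h3
      have h4 := hγ (s - p) (by omega) h3.le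
      rw [Nat.cast_sub h1.le, ← distInt_neg, show -(((s : ℝ) - p) * γ) = p * γ - s * γ by ring] at h4
      linarith) (by
      intro k hk k' hk' hkk
      obtain ⟨p, hp, rfl⟩ := Finset.mem_image.1 hk
      obtain ⟨p', hp', rfl⟩ := Finset.mem_image.1 hk'
      obtain ⟨h1, h2⟩ := hWm p hp
      obtain ⟨h1', h2'⟩ := hWm p' hp'
      by_contra! h3
      have h4 := hγ (s - p' - (s - p)) (by omega) h3.le
      rw [Nat.cast_sub hkk.le, Nat.cast_sub h1.le, Nat.cast_sub h1'.le,
        show (((s : ℝ) - p') - (s - p)) * γ = (p * γ - s * γ) - (p' * γ - s * γ) by ring] at h4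
      have h5 := distInt_sub_le (p * γ - s * γ) (p' * γ - s * γ)
      have h6 : 4 * A * Z ^ 2 / Y = 2 * A * Z ^ 2 / Y + 2 * A * Z ^ 2 / Y := by ring
      linarith)
    rw [Finset.card_image_of_injOn hinj] at hgap
    rw [le_div_iff₀ hT']
    exact_mod_cast hgap
  have hcard : (X.card : ℝ) ≤ s / Z + s / T := by
    rw [← hsplit]; push_cast; linarith
  calc ∑ p ∈ X, d * min (f (p * d) / (p * d : ℕ)) (f (s * d) / (s * d : ℕ))
      ≤ ∑ p ∈ X, d * (f (s * d) / (s * d : ℕ)) := by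
        apply Finset.sum_le_sum
        intro p _
        gcongr
        exact min_le_right _ _
    _ = X.card * (d * (f (s * d) / (s * d : ℕ))) := by rw [Finset.sum_const, nsmul_eq_mul]
    _ ≤ (s / Z + s / T) * (d * (f (s * d) / (s * d : ℕ))) := by gcongr
    _ = _ := by push_cast; field_simp

end RowBounds

/-- Bound for the sum of the overlap errors of the `q < r` with a fixed `r`. -/
theorem RowBounds.sum_gcd_le {S : Set ℕ} {f : ℕ → ℝ} {γ β γ' A Λ ℓ Y Z K : ℝ} {r : ℕ}
    (h : RowBounds S f γ β γ' A Λ ℓ Y Z r) (hK1 : 1 ≤ K) (hKY : K ≤ Y)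
    (hTZ : (r.divisors.card : ℝ) ≤ Z)
    (hγ : ∀ k : ℕ, 0 < k → k ≤ r.divisors.card → 4 * A * Z ^ 2 / Y < distInt (k * γ))
    (Q : Finset ℕ) (hQS : ∀ q ∈ Q, q ∈ S) (hQr : ∀ q ∈ Q, q < r)
    (hQK : ∀ q ∈ Q, (r : ℝ) ≤ K * (q.gcd r) * ℓ ^ 2 * q)
    (hclose : ∀ q ∈ Q, distInt ((q / q.gcd r : ℕ) * γ - (r / q.gcd r : ℕ) * γ)
      ≤ 2 * max (f q / q) (f r / r) * (q * r / q.gcd r)) :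
    ∑ q ∈ Q, (q.gcd r) * min (f q / q) (f r / r)
      ≤ f r * (2 + 148480 * (Real.logb 2 K + 1 + Real.logb 2 (ℓ ^ 2)) * (Real.logb 2 r + 1)
        * (8 + Real.log (Real.log r + 1)) ^ 2 * A / Λ) := by
  classical
  have hr0 : 0 < r := h.pos r h.mem
  have hr1 : (1 : ℝ) ≤ r := by exact_mod_cast hr0
  have hA := h.A_pos
  have hΛ := h.one_le_Λ
  have hℓ := h.one_le_ℓ
  have hZ := h.one_le_Z
  have hfr := h.f_pos h.mem le_rfl
  set T := r.divisors.card with hT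
  have hT0 : 0 < T := Finset.card_pos.2 ⟨1, Nat.one_mem_divisors.2 hr0.ne'⟩
  have hT' : (0 : ℝ) < T := by exact_mod_cast hT0
  set a := Real.logb 2 K + 1 + Real.logb 2 (ℓ ^ 2) with ha
  have hlr : 0 ≤ Real.logb 2 r := Real.logb_nonneg (by norm_num) hr1
  have hlK : 0 ≤ Real.logb 2 K := Real.logb_nonneg (by norm_num) hK1
  have hll : 0 ≤ Real.logb 2 (ℓ ^ 2) := Real.logb_nonneg (by norm_num) (one_le_pow₀ hℓ)
  have ha1 : 1 ≤ a := by linarith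
  have hfiber : ∀ d ∈ r.divisors, ∑ q ∈ Q.filter (fun q => q.gcd r = d),
      (q.gcd r) * min (f q / q) (f r / r)
      ≤ f r * (1 / Z + 1 / T) + (2 * a * (Real.logb 2 r + 1) * (18560 * A * f r / Λ))
        * ((1 + Real.log d) / d) := by
    intro d hd
    have hd0 : 0 < d := Nat.pos_of_mem_divisors hd
    have hd1 : (1 : ℝ) ≤ d := by exact_mod_cast hd0
    have hld : 0 ≤ Real.log d := Real.log_nonneg hd1
    obtain ⟨s, hs⟩ := Nat.dvd_of_mem_divisors hd
    rw [mul_comm] at hs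
    set W := Q.filter (fun q => q.gcd r = d) with hW
    have hWm : ∀ q ∈ W, q ∈ Q ∧ q.gcd r = d ∧ q / d * d = q := by
      intro q hq
      obtain ⟨h1, h2⟩ := Finset.mem_filter.1 hq
      exact ⟨h1, h2, Nat.div_mul_cancel (h2 ▸ Nat.gcd_dvd_left q r)⟩
    have hinj : Set.InjOn (fun q => q / d) (W : Set ℕ) := by
      intro x hx y hy hxy
      dsimp only at hxy
      rw [← (hWm x hx).2.2, ← (hWm y hy).2.2, hxy]
    have hsum : ∑ q ∈ W, (q.gcd r) * min (f q / q) (f r / r)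
        = ∑ p ∈ W.image (fun q => q / d),
          d * min (f (p * d) / (p * d : ℕ)) (f (s * d) / (s * d : ℕ)) := by
      rw [Finset.sum_image hinj]
      refine Finset.sum_congr rfl fun q hq => ?_
      obtain ⟨_, h2, h3⟩ := hWm q hq
      rw [h3, h2, hs]
    have hXS : ∀ p ∈ W.image (fun q => q / d), p * d ∈ S := by
      intro p hp
      obtain ⟨q, hq, rfl⟩ := Finset.mem_image.1 hp
      rw [(hWm q hq).2.2]; exact hQS q (hWm q hq).1
    have hXs : ∀ p ∈ W.image (fun q => q / d), p < s := by
      intro p hp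
      obtain ⟨q, hq, rfl⟩ := Finset.mem_image.1 hp
      rw [Nat.div_lt_iff_lt_mul hd0, ← hs]
      exact hQr q (hWm q hq).1
    have hsd : r / d = s := by rw [hs, Nat.mul_div_cancel _ hd0]
    have hXclose : ∀ p ∈ W.image (fun q => q / d), distInt (p * γ - s * γ)
        ≤ 2 * max (f (p * d) / (p * d : ℕ)) (f (s * d) / (s * d : ℕ)) * (p * s * d) := by
      intro p hp
      obtain ⟨q, hq, rfl⟩ := Finset.mem_image.1 hp
      obtain ⟨h1, h2, h3⟩ := hWm q hq
      have h4 := hclose q h1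
      rw [h2, hsd] at h4
      rw [h3, ← hs]
      have h5 : (q : ℝ) = ((q / d : ℕ) : ℝ) * d := by exact_mod_cast h3.symm
      have h6 : (r : ℝ) = (s : ℝ) * d := by exact_mod_cast hs
      have h7 : (q : ℝ) * r / d = ((q / d : ℕ) : ℝ) * s * d := by
        rw [h6, ← mul_assoc, mul_div_assoc, div_self (by positivity), mul_one]
        linear_combination (s : ℝ) * h5
      rwa [h7] at h4
    have hXK : ∀ p ∈ W.image (fun q => q / d), (s : ℝ) ≤ K * d * ℓ ^ 2 * p := by
      intro p hp
      obtain ⟨q, hq, rfl⟩ := Finset.mem_image.1 hp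
      obtain ⟨h1, h2, h3⟩ := hWm q hq
      have h4 := hQK q h1
      rw [h2] at h4
      have h5 : (q : ℝ) = ((q / d : ℕ) : ℝ) * d := by exact_mod_cast h3.symm
      have h6 : (r : ℝ) = (s : ℝ) * d := by exact_mod_cast hs
      rw [h5, h6, ← mul_assoc] at h4
      exact le_of_mul_le_mul_right h4 (by positivity)
    rw [hsum]
    have hpos1 : 0 ≤ f r * (1 / Z + 1 / T) := by positivity
    have hpos2 : 0 ≤ (2 * a * (Real.logb 2 r + 1) * (18560 * A * f r / Λ))
        * ((1 + Real.log d) / d) := by positivity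
    have h' : RowBounds S f γ β γ' A Λ ℓ Y Z (s * d) := hs ▸ h
    rcases le_or_gt (d : ℝ) Y with hdY | hdY
    · refine (h'.sum_small_gcd_le hK1 hKY hd0 hdY _ hXS (fun p hp => (hXs p hp).le) hXK
        hXclose).trans (le_trans ?_ (le_add_of_nonneg_left hpos1))
      rw [← hs]
      have e1 : Real.logb 2 (K * d * ℓ ^ 2) + 1 ≤ 2 * a * (1 + Real.log d) := by
        rw [Real.logb_mul (by positivity) (by positivity), Real.logb_mul (by positivity) (by positivity)]
        have e2 : Real.logb 2 d ≤ 2 * Real.log d := by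
          rw [Real.logb, div_le_iff₀ (Real.log_pos (by norm_num))]
          nlinarith [Real.log_two_gt_d9]
        nlinarith
      calc (Real.logb 2 (K * d * ℓ ^ 2) + 1) * (Real.logb 2 r + 1) * (18560 * A * f r / (d * Λ))
          ≤ (2 * a * (1 + Real.log d)) * (Real.logb 2 r + 1) * (18560 * A * f r / (d * Λ)) := by
            gcongr
        _ = _ := by field_simp
    · exact (h'.sum_large_gcd_le hT0 hγ hd0 hdY _ hXS hXs hXclose).trans
        (by rw [← hs]; exact le_add_of_nonneg_right hpos2)
  have hmaps : ∀ q ∈ Q, q.gcd r ∈ r.divisors := fun q _ =>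
    Nat.mem_divisors.2 ⟨Nat.gcd_dvd_right q r, hr0.ne'⟩
  rw [← Finset.sum_fiberwise_of_maps_to hmaps]
  refine (Finset.sum_le_sum hfiber).trans ?_
  rw [Finset.sum_add_distrib, Finset.sum_const, nsmul_eq_mul, ← Finset.mul_sum, ← hT]
  -- `T` is the number of divisors, so the term `1 / T` adds up to `1` over all of them, and `1 / Z`
  -- to at most `1` since `T ≤ Z`.
  have e1 : (T : ℝ) * (f r * (1 / Z + 1 / T)) ≤ f r * 2 := by
    have e2 : (T : ℝ) * (1 / Z + 1 / T) ≤ 2 := by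
      rw [mul_add, mul_one_div, mul_one_div, div_self hT'.ne']
      have := (div_le_one (by linarith : (0 : ℝ) < Z)).2 hTZ
      linarith
    calc _ = f r * (T * (1 / Z + 1 / T)) := by ring
      _ ≤ _ := by gcongr
  have e3 := sum_divisors_one_add_log_div_le r
  have hc : 0 ≤ 2 * a * (Real.logb 2 r + 1) * (18560 * A * f r / Λ) := by positivity
  calc _ ≤ f r * 2 + (2 * a * (Real.logb 2 r + 1) * (18560 * A * f r / Λ))
        * (4 * (8 + Real.log (Real.log r + 1)) ^ 2) := add_le_add e1 (by gcongr)
    _ = _ := by ring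

/-! ### From row sums to full measure. -/

theorem sum_range_sum_range_symm (F : ℕ → ℕ → ℝ) (hF : ∀ m n, F m n = F n m) (N : ℕ) :
    ∑ n ∈ Finset.range N, ∑ m ∈ Finset.range N, F n m
      = ∑ n ∈ Finset.range N, (F n n + 2 * ∑ m ∈ Finset.range n, F n m) := by
  induction N with
  | zero => simp
  | succ N ih =>
    rw [Finset.sum_range_succ, Finset.sum_range_succ _ N]
    simp_rw [Finset.sum_range_succ _ N]
    rw [Finset.sum_add_distrib, ih, Finset.sum_congr rfl fun n _ => hF n N]
    ring

/-- The overlap of two of the sets `approxSet`: the main term, and an error which vanishes unless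
`γ` is well approximable. -/
theorem volume_inter_approxSet_le_min {q r : ℕ} (hq : 0 < q) (hr : 0 < r) (γ : ℝ) {a b : ℝ}
    (ha : 0 < a) (hb : 0 < b) :
    (volume (approxSet q (γ : UnitAddCircle) a ∩ approxSet r (γ : UnitAddCircle) b)).toReal
      ≤ 4 * a * b + 2 * ((q.gcd r) * min (a / q) (b / r)) := by
  obtain ⟨d, p, s, hd, hps, rfl, rfl⟩ := Nat.exists_coprime' (Nat.gcd_pos_of_pos_left r hq)
  have hp : 0 < p := Nat.pos_of_mul_pos_right hq
  have hs : 0 < s := Nat.pos_of_mul_pos_right hr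
  have hd' : (0 : ℝ) < d := by exact_mod_cast hd
  have hp' : (0 : ℝ) < p := by exact_mod_cast hp
  have hs' : (0 : ℝ) < s := by exact_mod_cast hs
  rw [Nat.gcd_mul_right, hps.gcd_eq_one, one_mul]
  have h1 := volume_inter_approxSet_le hp hd hps (γ : UnitAddCircle) ha hb
  have h2 := volume_inter_approxSet_le hs hd hps.symm (γ : UnitAddCircle) hb ha
  rw [Set.inter_comm] at h2
  push_cast
  rcases min_choice (a / ((p : ℝ) * d)) (b / ((s : ℝ) * d)) with hm | hm <;> rw [hm]
  · refine h1.trans (le_of_eq ?_)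
    field_simp
  · refine h2.trans (le_of_eq ?_)
    field_simp

/-- The threshold `s a + p b` of `inter_approxSet_eq_empty` is a sum of two terms, each at most the
maximum times `q r / gcd(q, r)`; hence the factor `2`. -/
theorem inter_approxSet_eq_empty_of_distInt {q r : ℕ} (hq : 0 < q) (hr : 0 < r) (γ : ℝ) {a b : ℝ}
    (h : 2 * max (a / q) (b / r) * (q * r / q.gcd r)
      < distInt ((q / q.gcd r : ℕ) * γ - (r / q.gcd r : ℕ) * γ)) :
    approxSet q (γ : UnitAddCircle) a ∩ approxSet r (γ : UnitAddCircle) b = ∅ := by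
  obtain ⟨d, p, s, hd, hps, rfl, rfl⟩ := Nat.exists_coprime' (Nat.gcd_pos_of_pos_left r hq)
  have hp : 0 < p := Nat.pos_of_mul_pos_right hq
  have hs : 0 < s := Nat.pos_of_mul_pos_right hr
  have hd' : (0 : ℝ) < d := by exact_mod_cast hd
  have hp' : (0 : ℝ) < p := by exact_mod_cast hp
  have hs' : (0 : ℝ) < s := by exact_mod_cast hs
  rw [Nat.gcd_mul_right, hps.gcd_eq_one, one_mul, Nat.mul_div_cancel _ hd,
    Nat.mul_div_cancel _ hd] at h
  push_cast at h
  refine inter_approxSet_eq_empty (γ : UnitAddCircle) ?_ hs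
  have h3 : ‖((s : ℤ) - p) • (γ : UnitAddCircle)‖ = distInt (p * γ - s * γ) := by
    rw [← distInt_neg, distInt_eq_norm, ← AddCircle.coe_zsmul]
    congr 2
    simp only [zsmul_eq_mul]; push_cast; ring
  rw [h3]
  refine le_trans ?_ h.le
  have e1 : s * a = a / (p * d) * (p * d * (s * d) / d) := by field_simp
  have e2 : p * b = b / (s * d) * (p * d * (s * d) / d) := by field_simp
  have e3 : (0 : ℝ) ≤ p * d * (s * d) / d := by positivity
  rw [e1, e2, two_mul, add_mul]
  exact add_le_add (mul_le_mul_of_nonneg_right (le_max_left _ _) e3)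
    (mul_le_mul_of_nonneg_right (le_max_right _ _) e3)

/-- A criterion for the set of `x` with `‖q x - γ‖ < f q` for infinitely many `q ∈ S` to be of full
measure, in terms of sums of greatest common divisors. -/
theorem volume_setOf_infinite_eq_one (S : Set ℕ) (f : ℕ → ℝ) (γ : ℝ) (hS0 : ∀ q ∈ S, 0 < q)
    (hf0 : ∀ q ∈ S, 0 < f q) (hf1 : ∀ q ∈ S, f q ≤ 1 / 2) (hdiv : ¬ Summable (S.indicator f))
    (hrow : ∀ K : ℝ, 1 ≤ K → ∃ C : ℝ, ∀ r ∈ S, ∀ Q : Finset ℕ, (∀ q ∈ Q, q ∈ S) → (∀ q ∈ Q, q < r) →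
      (∀ q ∈ Q, max (f q / q) (f r / r) * (q * r / q.gcd r) < K) →
      (∀ q ∈ Q, distInt ((q / q.gcd r : ℕ) * γ - (r / q.gcd r : ℕ) * γ)
        ≤ 2 * max (f q / q) (f r / r) * (q * r / q.gcd r)) →
      ∑ q ∈ Q, (q.gcd r) * min (f q / q) (f r / r) ≤ C * f r) :
    volume {x : UnitAddCircle | {q : ℕ | q ∈ S ∧ x ∈ approxSet q γ (f q)}.Infinite} = 1 := by
  classical
  set A : ℕ → Set UnitAddCircle := fun q => if q ∈ S then approxSet q γ (f q) else ∅ with hA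
  have hAm : ∀ q, MeasurableSet (A q) := by
    intro q
    by_cases hq : q ∈ S
    · simp only [hA, if_pos hq]; exact measurableSet_approxSet _ _ _
    · simp only [hA, if_neg hq]; exact MeasurableSet.empty
  set μ : Measure UnitAddCircle := volume with hμ
  have : IsProbabilityMeasure μ := ⟨UnitAddCircle.measure_univ⟩
  have hAin : ∀ q ∈ S, A q = approxSet q γ (f q) := fun q hq => if_pos hq
  have hAout : ∀ q, q ∉ S → A q = ∅ := fun q hq => if_neg hq
  have hmeas : ∀ q, μ.real (A q) = 2 * S.indicator f q := by
    intro q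
    by_cases hq : q ∈ S
    · rw [hAin q hq, Set.indicator_of_mem hq, measureReal_def, volume_approxSet (hS0 q hq).ne',
        min_eq_right (by linarith [hf1 q hq]), ENNReal.toReal_ofReal (by linarith [hf0 q hq])]
    · rw [hAout q hq, Set.indicator_of_notMem hq]; simp
  have hset : {x : UnitAddCircle | {q : ℕ | q ∈ S ∧ x ∈ approxSet q γ (f q)}.Infinite}
      = {x | {q | x ∈ A q}.Infinite} := by
    ext x
    have : {q : ℕ | q ∈ S ∧ x ∈ approxSet q γ (f q)} = {q | x ∈ A q} := by
      ext q
      by_cases hq : q ∈ S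
      · simp [hAin q hq, hq]
      · simp [hAout q hq, hq]
    rw [Set.mem_ofPred_eq, Set.mem_ofPred_eq, this]
  rw [hset]
  refine measure_setOf_infinite_eq_one μ A hAm ?_ ?_
  · simp_rw [hmeas]
    rwa [summable_mul_left_iff two_ne_zero]
  intro ε hε
  set K := max 1 (1 / ε) with hK
  have hK1 : 1 ≤ K := le_max_left _ _
  have hKε : 1 / K ≤ ε := by
    rw [one_div_le (by linarith) hε]; exact le_max_right _ _
  obtain ⟨C, hC⟩ := hrow K hK1
  have ha0 : ∀ q, 0 ≤ μ.real (A q) := fun q => measureReal_nonneg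
  have hrowsum : ∀ r, ∑ q ∈ Finset.range r, μ.real (A r ∩ A q)
      ≤ (1 + ε) * ∑ q ∈ Finset.range r, μ.real (A r) * μ.real (A q) + C * μ.real (A r) := by
    intro r
    by_cases hr : r ∈ S
    swap
    · simp [hAout r hr]
    have hr0 := hS0 r hr
    have hr' : (0 : ℝ) < r := by exact_mod_cast hr0
    set P : ℕ → Prop := fun q => q ∈ S ∧ max (f q / q) (f r / r) * (q * r / q.gcd r) < K ∧
      distInt ((q / q.gcd r : ℕ) * γ - (r / q.gcd r : ℕ) * γ)
        ≤ 2 * max (f q / q) (f r / r) * (q * r / q.gcd r) with hP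
    have hQ := hC r hr ((Finset.range r).filter P) (fun q hq => (Finset.mem_filter.1 hq).2.1)
      (fun q hq => Finset.mem_range.1 (Finset.mem_filter.1 hq).1)
      (fun q hq => (Finset.mem_filter.1 hq).2.2.1) (fun q hq => (Finset.mem_filter.1 hq).2.2.2)
    have hterm : ∀ q ∈ Finset.range r, μ.real (A r ∩ A q) ≤ (1 + ε) * (μ.real (A r) * μ.real (A q))
        + if P q then 2 * ((q.gcd r) * min (f q / q) (f r / r)) else 0 := by
      intro q _
      by_cases hq : q ∈ S
      swap
      · have : ¬ P q := fun h => hq h.1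
        simp [hAout q hq, this]
      have hq0 := hS0 q hq
      have hq' : (0 : ℝ) < q := by exact_mod_cast hq0
      have hfq := hf0 q hq
      have hfr := hf0 r hr
      have hgcd : (0 : ℝ) < q.gcd r := by exact_mod_cast Nat.gcd_pos_of_pos_left r hq0
      have hmin : 0 < min (f q / q) (f r / r) := lt_min (by positivity) (by positivity)
      rw [hmeas, hmeas, Set.indicator_of_mem hq, Set.indicator_of_mem hr]
      rw [Set.inter_comm, hAin q hq, hAin r hr]
      have hov : μ.real (approxSet q (γ : UnitAddCircle) (f q) ∩ approxSet r γ (f r)) ≤ _ :=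
        volume_inter_approxSet_le_min hq0 hr0 γ hfq hfr
      by_cases hclose : distInt ((q / q.gcd r : ℕ) * γ - (r / q.gcd r : ℕ) * γ)
        ≤ 2 * max (f q / q) (f r / r) * (q * r / q.gcd r)
      swap
      · rw [inter_approxSet_eq_empty_of_distInt hq0 hr0 γ (not_le.1 hclose), measureReal_empty]
        have : ¬ P q := fun h => hclose h.2.2
        rw [if_neg this]
        positivity
      by_cases hlt : max (f q / q) (f r / r) * (q * r / q.gcd r) < K
      · rw [if_pos ⟨hq, hlt, hclose⟩]
        have : 0 ≤ ε * (f q * f r) := by positivity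
        linarith
      · have hnP : ¬ P q := fun h => hlt h.2.1
        rw [if_neg hnP]
        -- Minimum times maximum is the product, so a parameter of at least `K ≥ 1 / ε` makes the
        -- overlap error at most `ε f q f r`, which joins the main term.
        have hprod : ((q.gcd r) * min (f q / q) (f r / r))
            * (max (f q / q) (f r / r) * (q * r / q.gcd r)) = f q * f r := by
          calc _ = (min (f q / q) (f r / r) * max (f q / q) (f r / r)) * (q * r) := by field_simp
            _ = (f q / q * (f r / r)) * (q * r) := by rw [min_mul_max]
            _ = _ := by field_simp
        have e1 : ((q.gcd r) * min (f q / q) (f r / r)) * K ≤ f q * f r := by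
          rw [← hprod]
          exact mul_le_mul_of_nonneg_left (not_lt.1 hlt) (by positivity)
        have e2 : (q.gcd r) * min (f q / q) (f r / r) ≤ ε * (f q * f r) := by
          calc _ = (((q.gcd r) * min (f q / q) (f r / r)) * K) * (1 / K) := by field_simp
            _ ≤ (f q * f r) * ε := by gcongr
            _ = _ := by ring
        have : 0 ≤ ε * (f q * f r) := by positivity
        linarith
    refine (Finset.sum_le_sum hterm).trans ?_
    rw [Finset.sum_add_distrib, ← Finset.mul_sum, ← Finset.sum_filter, ← Finset.mul_sum, hmeas r,
      Set.indicator_of_mem hr]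
    have e := Finset.mul_sum ((Finset.range r).filter P)
      (fun q : ℕ => (q.gcd r : ℝ) * min (f q / q) (f r / r)) 2
    linarith
  refine ⟨1 + 2 * C, fun N => ?_⟩
  rw [sum_range_sum_range_symm (fun n m => μ.real (A n ∩ A m))
    (fun m n => by rw [Set.inter_comm]), sq, Finset.sum_mul_sum,
    sum_range_sum_range_symm (fun n m => μ.real (A n) * μ.real (A m)) (fun m n => mul_comm _ _),
    Finset.mul_sum, Finset.mul_sum, ← Finset.sum_add_distrib]
  refine Finset.sum_le_sum fun r _ => ?_
  have h1 := hrowsum r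
  have h2 : 0 ≤ (1 + ε) * (μ.real (A r) * μ.real (A r)) := by
    have := ha0 r
    positivity
  rw [Set.inter_self]
  linarith

/-! ### Iterated logarithms, divisor growth and admissible exponents. -/

theorem eventually_mul_logb_pow_le (n : ℕ) (C δ : ℝ) (hδ : 0 < δ) :
    ∀ᶠ x : ℝ in atTop, C * Real.logb 2 x ^ n ≤ δ * x := by
  have hl2 : 0 < Real.log 2 := Real.log_pos (by norm_num)
  have h := (Real.isLittleO_pow_log_id_atTop (n := n)).bound
    (show 0 < δ * Real.log 2 ^ n / (|C| + 1) by positivity)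
  filter_upwards [h, eventually_ge_atTop 1] with x hx hx1
  rw [Real.norm_of_nonneg (pow_nonneg (Real.log_nonneg hx1) n), id, Real.norm_of_nonneg (by linarith),
    div_mul_eq_mul_div, le_div_iff₀ (by positivity)] at hx
  rw [Real.logb, div_pow, mul_div_assoc', div_le_iff₀ (by positivity)]
  have h1 : 0 ≤ Real.log x ^ n := pow_nonneg (Real.log_nonneg hx1) n
  nlinarith [mul_le_mul_of_nonneg_right (le_abs_self C) h1]

/-- The growth conditions on iterated logarithms used in the row estimate, for `L = log₂ r`. -/
theorem eventually_iterated_logb (M c δ : ℝ) (hc : 0 < c) (hδ : 0 < δ) :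
    ∀ᶠ L : ℝ in atTop, 1 ≤ Real.logb 2 (Real.logb 2 L) ∧ M ≤ Real.logb 2 (Real.logb 2 L) ∧
      2 ≤ Real.logb 2 L ∧ 4 ≤ L ∧
      M * Real.logb 2 L ≤ 2 * c * L / √(Real.logb 2 (Real.logb 2 L)) ∧
      √L * (2 * Real.logb 2 L) + 4 * L / Real.logb 2 L + 1
        ≤ δ * L / Real.logb 2 (Real.logb 2 L) := by
  have ht : Tendsto (Real.logb 2) atTop atTop := Real.tendsto_logb_atTop (by norm_num)
  filter_upwards [(ht.comp ht).eventually_ge_atTop (max 1 M), ht.eventually_ge_atTop 2,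
    eventually_ge_atTop 4, eventually_mul_logb_pow_le 2 |M| (2 * c) (by positivity),
    eventually_mul_logb_pow_le 4 64 (δ ^ 2) (by positivity),
    ht.eventually (eventually_mul_logb_pow_le 1 4 (δ / 4) (by positivity)),
    ht.eventually (eventually_mul_logb_pow_le 1 1 1 one_pos),
    eventually_mul_logb_pow_le 1 1 (δ / 4) (by positivity)] with L h1 h2 h3 h4 h5 h6 h7 h8
  simp only [Function.comp_apply, pow_one, one_mul, max_le_iff] at h1 h6 h7 h8
  set u := Real.logb 2 L with hu
  set v := Real.logb 2 u with hv
  have hL : 0 < L := by linarith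
  refine ⟨h1.1, h1.2, h2, h3, ?_, ?_⟩
  · have hX0 : 0 < √v := Real.sqrt_pos.2 (by linarith)
    have hX : √v ≤ u := by
      refine le_trans ?_ h7
      rw [Real.sqrt_le_left (by linarith)]
      nlinarith
    rw [le_div_iff₀ hX0]
    have h9 : M * u * √v ≤ |M| * u * u := by
      have : M * u ≤ |M| * u := mul_le_mul_of_nonneg_right (le_abs_self M) (by linarith)
      exact mul_le_mul this hX hX0.le (by positivity)
    linarith
  · have hv0 : 0 < v := by linarith
    rw [le_div_iff₀ hv0]
    have hs : √L * √L = L := Real.mul_self_sqrt hL.le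
    have hs0 : 0 < √L := Real.sqrt_pos.2 hL
    have e1 : 8 * u ^ 2 ≤ δ * √L := by
      refine le_of_sq_le_sq ?_ (by positivity)
      calc (8 * u ^ 2) ^ 2 = 64 * u ^ 4 := by ring
        _ ≤ δ ^ 2 * L := h5
        _ = (δ * √L) ^ 2 := by rw [mul_pow, sq (√L), hs]
    have e2 : √L * (2 * u) * v ≤ δ / 4 * L := by
      calc √L * (2 * u) * v ≤ √L * (2 * u) * u := by gcongr
        _ = √L * (8 * u ^ 2) / 4 := by ring
        _ ≤ √L * (δ * √L) / 4 := by gcongr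
        _ = δ / 4 * (√L * √L) := by ring
        _ = δ / 4 * L := by rw [hs]
    have e3 : 4 * L / u * v ≤ δ / 4 * L := by
      rw [div_mul_eq_mul_div, div_le_iff₀ (by linarith)]
      nlinarith
    have e4 : v ≤ δ / 4 * L := h7.trans h8
    nlinarith [mul_pos hδ hL]

/-- `log_card_divisors_le` with the primes split at `⌊√(log₂ r)⌋`, whose logarithm is at least a
quarter of `log₂ log₂ r`. -/
theorem logb_card_divisors_le (r : ℕ) (hr : r ≠ 0) (hL : 4 ≤ Real.logb 2 r)
    (hu : 4 ≤ Real.logb 2 (Real.logb 2 r)) :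
    Real.logb 2 r.divisors.card ≤ √(Real.logb 2 r) * (2 * Real.logb 2 (Real.logb 2 r))
      + 4 * Real.logb 2 r / Real.logb 2 (Real.logb 2 r) := by
  have hl2 : 0 < Real.log 2 := Real.log_pos (by norm_num)
  set L := Real.logb 2 r with hLdef
  set u := Real.logb 2 L with hudef
  have hL0 : 0 < L := by linarith
  have hs2 : 2 ≤ √L := Real.le_sqrt_of_sq_le (by linarith)
  set P := ⌊√L⌋₊ with hP
  have hP2 : 2 ≤ P := Nat.le_floor (by exact_mod_cast hs2)
  have hP1 : (P : ℝ) ≤ √L := Nat.floor_le (by linarith)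
  have hP3 : √L / 2 ≤ P := by
    have := Nat.lt_floor_add_one (√L)
    rw [← hP] at this
    linarith
  have h := log_card_divisors_le r P hr hP2
  have hPpos : (0 : ℝ) < P := by positivity
  have hlogP : u / 4 ≤ Real.logb 2 P := by
    have e1 : Real.logb 2 (√L / 2) ≤ Real.logb 2 P :=
      Real.logb_le_logb_of_le (by norm_num) (by positivity) hP3
    rw [Real.logb_div (by positivity) (by norm_num), Real.logb_self_eq_one (by norm_num),
      Real.sqrt_eq_rpow, Real.logb_rpow_eq_mul_logb_of_pos hL0] at e1
    linarith
  have hlogP' : Real.log P = Real.logb 2 P * Real.log 2 := by rw [Real.logb]; field_simp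
  have hlogr : Real.log r = L * Real.log 2 := by rw [hLdef, Real.logb]; field_simp
  have hNat : (Nat.log 2 r : ℝ) + 1 ≤ L ^ 2 := by
    have : (Nat.log 2 r : ℝ) ≤ L := by
      rw [hLdef]; exact_mod_cast Real.natLog_le_logb r 2
    nlinarith
  have e2 : Real.log (Nat.log 2 r + 1) ≤ 2 * u * Real.log 2 := by
    have h3 : Real.log (Nat.log 2 r + 1) ≤ Real.log (L ^ 2) := Real.log_le_log (by positivity) hNat
    rw [Real.log_pow] at h3
    have : Real.log L = u * Real.log 2 := by rw [hudef, Real.logb]; field_simp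
    rw [this] at h3
    push_cast at h3
    linarith
  have hu0 : 0 < u := by linarith
  have hlP0 : 0 < Real.logb 2 P := by linarith
  have e3 : Real.log 2 * Real.log r / Real.log P ≤ 4 * L / u * Real.log 2 := by
    rw [hlogP', hlogr]
    calc Real.log 2 * (L * Real.log 2) / (Real.logb 2 P * Real.log 2)
        = L / Real.logb 2 P * Real.log 2 := by field_simp
      _ ≤ L / (u / 4) * Real.log 2 := by gcongr
      _ = _ := by field_simp
  rw [Real.logb, div_le_iff₀ hl2]
  calc _ ≤ P * Real.log (Nat.log 2 r + 1) + Real.log 2 * Real.log r / Real.log P := h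
    _ ≤ √L * (2 * u * Real.log 2) + 4 * L / u * Real.log 2 := by
        have : 0 ≤ Real.log ((Nat.log 2 r : ℝ) + 1) := Real.log_nonneg (by simp)
        gcongr
    _ = _ := by ring

/-- Cauchy condensation turns this into the sum of `1 / (k + 1)²`. Radii below these terms can be
discarded without affecting divergence. -/
theorem summable_one_div_mul_sq_one_add_logb :
    Summable fun q : ℕ => 1 / ((q : ℝ) * (1 + Real.logb 2 q) ^ 2) := by
  have hl : ∀ n : ℕ, 0 ≤ Real.logb 2 n := by
    intro n
    rcases Nat.eq_zero_or_pos n with rfl | hn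
    · simp
    · exact Real.logb_nonneg (by norm_num) (by exact_mod_cast hn)
  rw [← summable_condensed_iff_of_nonneg]
  · have h1 : Summable fun k : ℕ => 1 / ((k + 1 : ℕ) : ℝ) ^ 2 :=
      (summable_nat_add_iff 1).2 (Real.summable_one_div_nat_pow.2 one_lt_two)
    refine h1.congr fun k => ?_
    have : Real.logb 2 ((2 ^ k : ℕ) : ℝ) = k := by
      push_cast
      rw [← Real.rpow_natCast, Real.logb_rpow (by norm_num) (by norm_num)]
    rw [this]
    push_cast
    field_simp
    ring
  · intro n
    have := hl n
    positivity
  · intro m n hm hmn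
    have hm' : (0 : ℝ) < m := by exact_mod_cast hm
    have := hl m
    have h2 : Real.logb 2 m ≤ Real.logb 2 n :=
      Real.logb_le_logb_of_le (by norm_num) hm' (by exact_mod_cast hmn)
    have h3 : (m : ℝ) ≤ n := by exact_mod_cast hmn
    gcongr

/-- Applying admissibility to the doubled pair `(2 k₁, 2 k₂)` brings in pairs of height `1`, at the
price of the factors `1 / 2` and `2 H`. -/
theorem IsAdmissibleExponent.le_distInt {γ β s H : ℝ} {N : ℕ} (h : IsAdmissibleExponent γ β N s)
    (hs : 0 ≤ s) (hHN : 2 * H ≤ N) {k₁ k₂ : ℤ} (h1 : ((|k₁| : ℤ) : ℝ) ≤ H)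
    (h2 : ((|k₂| : ℤ) : ℝ) ≤ H) (hne : (k₁, k₂) ≠ (0, 0)) :
    1 / 2 * (2 * H) ^ (-s) ≤ distInt (k₁ * γ + k₂ * β) := by
  set m := max |2 * k₁| |2 * k₂| with hm
  have hm2 : 2 ≤ m := by
    have : k₁ ≠ 0 ∨ k₂ ≠ 0 := by
      by_contra! h'
      exact hne (by rw [h'.1, h'.2])
    rcases this with h' | h'
    · exact le_max_of_le_left (by have := Int.one_le_abs h'; rw [abs_mul]; norm_num; linarith)
    · exact le_max_of_le_right (by have := Int.one_le_abs h'; rw [abs_mul]; norm_num; linarith)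
  have hmH : (m : ℝ) ≤ 2 * H := by
    rw [hm, Int.cast_max, max_le_iff, abs_mul, abs_mul]
    push_cast at h1 h2 ⊢
    norm_num
    exact ⟨h1, h2⟩
  have hm0 : (0 : ℝ) < m := by
    have : (2 : ℝ) ≤ m := by exact_mod_cast hm2
    linarith
  have h3 := h (2 * k₁) (2 * k₂) hm2 (by exact_mod_cast hmH.trans hHN)
  have h4 : (2 * H) ^ (-s) ≤ (m : ℝ) ^ (-s) :=
    Real.rpow_le_rpow_of_nonpos hm0 hmH (by linarith)
  have h5 : distInt ((2 * k₁ : ℤ) * γ + (2 * k₂ : ℤ) * β) ≤ 2 * distInt (k₁ * γ + k₂ * β) := by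
    have := distInt_add_le (k₁ * γ + k₂ * β) (k₁ * γ + k₂ * β)
    push_cast
    rw [show 2 * (k₁ : ℝ) * γ + 2 * k₂ * β = (k₁ * γ + k₂ * β) + (k₁ * γ + k₂ * β) by ring]
    linarith
  linarith [h4.trans (h3.trans h5)]

/-- The infimum need not be attained, but enlarging an admissible exponent keeps it admissible
because heights are at least `2`. -/
theorem isAdmissibleExponent_of_jointExponent_lt {γ β s : ℝ} {N : ℕ}
    (h : jointExponent γ β N < ENNReal.ofReal s) : IsAdmissibleExponent γ β N s := by
  rw [jointExponent, iInf_lt_iff] at h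
  obtain ⟨t, ht⟩ := h
  rw [iInf_lt_iff] at ht
  obtain ⟨⟨ht0, hadm⟩, hts⟩ := ht
  have hts' : t < s := (ENNReal.ofReal_lt_ofReal_iff_of_nonneg ht0.le).1 hts
  intro k₁ k₂ h1 h2
  refine le_trans ?_ (hadm k₁ k₂ h1 h2)
  apply Real.rpow_le_rpow_of_exponent_le
  · have : (2 : ℝ) ≤ ((max |k₁| |k₂| : ℤ) : ℝ) := by exact_mod_cast h1
    linarith
  · linarith

/-! ### Choice of the parameters of the row estimate. -/

/-- The indices with a radius `f q` which is not too small. -/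
def largeRadiusSet (f : ℕ → ℝ) (β γ' c : ℝ) (q₀ : ℕ) : Set ℕ :=
  {q | q₀ ≤ q ∧ q ∈ sumRange (omegaFun c) β γ' ∧ 1 / (q * (1 + Real.logb 2 q) ^ 2) ≤ f q}

section Row

variable {ψ : ℕ → ℝ} {γ β γ' c A C : ℝ} {q₀ r : ℕ}

/-- The last hypothesis means `q ≥ √r`, so the iterated logarithms of `q` agree with those of `r` up
to a factor `2`, or an additive `1`. -/
theorem logb_facts_of_le_mul {L u v : ℝ} {q : ℕ} (hq : 0 < q) (hL : L = Real.logb 2 r)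
    (hu : u = Real.logb 2 L) (hv : v = Real.logb 2 u) (hv4 : 4 ≤ v) (hu2 : 2 ≤ u) (hL4 : 4 ≤ L)
    (hqr : q ≤ r) (h : (r : ℝ) ≤ 2 ^ (L / 2) * q) :
    L / 2 ≤ Real.logb 2 q ∧ Real.logb 2 q ≤ L ∧ u / 2 ≤ Real.logb 2 (Real.logb 2 q) ∧
      1 < Real.logb 2 (Real.logb 2 q) ∧
      √v / 2 ≤ √(Real.logb 2 (Real.logb 2 (Real.logb 2 q))) := by
  have hq' : (0 : ℝ) < q := by exact_mod_cast hq
  have hr' : (0 : ℝ) < r := lt_of_lt_of_le hq' (by exact_mod_cast hqr)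
  have h1 : L / 2 ≤ Real.logb 2 q := by
    have h2 := Real.logb_le_logb_of_le (by norm_num : (1 : ℝ) < 2) hr' h
    rw [Real.logb_mul (by positivity) (by positivity), Real.logb_rpow (by norm_num) (by norm_num),
      ← hL] at h2
    linarith
  have h2 : Real.logb 2 q ≤ L := by
    rw [hL]; exact Real.logb_le_logb_of_le (by norm_num) hq' (by exact_mod_cast hqr)
  have hl : ∀ x y : ℝ, 0 < x → x / 2 ≤ y → Real.logb 2 x - 1 ≤ Real.logb 2 y := by
    intro x y hx hxy
    have := Real.logb_le_logb_of_le (by norm_num : (1 : ℝ) < 2) (by positivity) hxy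
    rwa [Real.logb_div hx.ne' (by norm_num), Real.logb_self_eq_one (by norm_num)] at this
  have h3 := hl L _ (by linarith) h1
  rw [← hu] at h3
  have hu4 : 4 < u := by
    by_contra! h'
    have : v ≤ Real.logb 2 4 := by
      rw [hv]; exact Real.logb_le_logb_of_le (by norm_num) (by linarith) h'
    rw [show (4 : ℝ) = 2 ^ (2 : ℝ) by norm_num, Real.logb_rpow (by norm_num) (by norm_num)] at this
    linarith
  have h4 := hl u (Real.logb 2 (Real.logb 2 q)) (by linarith) (by linarith)
  rw [← hv] at h4
  refine ⟨h1, h2, by linarith, by linarith, ?_⟩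
  apply Real.le_sqrt_of_sq_le
  rw [div_pow, Real.sq_sqrt (by linarith)]
  linarith

/-- Here `Z = 2 ^ E` is the bound for `1 / ‖qβ - γ'‖` that `ω` provides when `√r ≤ q ≤ r`; the `2`
in `E = 2 c L / √v` pays for replacing the triple logarithm of `q` by that of `r`. The threshold is
`Y = Z ^ 8`. -/
theorem rowBounds_of_large {L u v E M : ℝ} (hA : 0 < A) (hC : 5 ≤ C) (hc : 0 < c)
    (hcC : 200 * C * c ≤ 1)
    (hψ : ∀ q : ℕ, q₀ ≤ q → ψ q ≤ A / (q * Real.logb 2 q * Real.logb 2 (Real.logb 2 q) ^ 3))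
    (hL : L = Real.logb 2 r)
    (hu : u = Real.logb 2 L) (hv : v = Real.logb 2 u) (hE : E = 2 * c * L / √v) (hv4 : 4 ≤ v)
    (hu2 : 2 ≤ u) (hL4 : 4 ≤ L) (hM4 : 4 ≤ M) (hME : M * u ≤ E)
    (hadm : IsAdmissibleExponent γ β r (C * √v))
    (hr : r ∈ largeRadiusSet (fun q => ψ q / distInt (q * β - γ')) β γ' c q₀) :
    RowBounds (largeRadiusSet (fun q => ψ q / distInt (q * β - γ')) β γ' c q₀)
      (fun q => ψ q / distInt (q * β - γ')) γ β γ' (16 * A) (L * u ^ 3) (1 + L) (2 ^ (8 * E)) (2 ^ E)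
      r := by
  have hrpos : 0 < r := hr.2.1.1
  have hr' : (0 : ℝ) < r := by exact_mod_cast hrpos
  have hrL : (r : ℝ) = 2 ^ L := by rw [hL, Real.rpow_logb (by norm_num) (by norm_num) hr']
  have hX1 : 1 ≤ √v := by rw [Real.one_le_sqrt]; linarith
  have hE0 : 0 ≤ E := by rw [hE]; positivity
  have hEX : E * √v = 2 * c * L := by rw [hE]; field_simp
  have hEc : E ≤ 2 * c * L := by rw [← hEX]; exact le_mul_of_one_le_right hE0 hX1
  have hc1 : c * 1000 ≤ 1 := by nlinarith
  have hEL : 500 * E ≤ L := by nlinarith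
  have hpow : ∀ x y : ℝ, x ≤ y → (2 : ℝ) ^ x ≤ 2 ^ y := fun x y h =>
    Real.rpow_le_rpow_of_exponent_le (by norm_num) h
  have hYn : ∀ n : ℕ, ((2 : ℝ) ^ (8 * E)) ^ n = 2 ^ (8 * E * n) := fun n => by
    rw [← Real.rpow_natCast, ← Real.rpow_mul (by norm_num)]
  have hqr : ∀ q : ℕ, (r : ℝ) ≤ ((2 : ℝ) ^ (8 * E)) ^ 3 * q → (r : ℝ) ≤ 2 ^ (L / 2) * q := by
    intro q h
    refine h.trans ?_
    rw [hYn]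
    gcongr
    · norm_num
    · push_cast; linarith
  have hdist : ∀ q ∈ largeRadiusSet (fun q => ψ q / distInt (q * β - γ')) β γ' c q₀, q ≤ r →
      (r : ℝ) ≤ ((2 : ℝ) ^ (8 * E)) ^ 3 * q → 1 / 2 ^ E ≤ distInt (q * β - γ') := by
    intro q hq hqr1 hqr2
    have hq0 : (0 : ℝ) < q := by exact_mod_cast hq.2.1.1
    obtain ⟨h1, h2, h3, h4, h5⟩ := logb_facts_of_le_mul hq.2.1.1 hL hu hv hv4 hu2 hL4 hqr1 (hqr q hqr2)
    refine le_trans ?_ hq.2.1.2.1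
    rw [omegaFun, log₂, log₂, if_neg (not_le.2 h4), log₂, one_div, ← Real.rpow_neg (by norm_num)]
    rw [show (q : ℝ) ^ (-(c / √(Real.logb 2 (Real.logb 2 (Real.logb 2 q)))))
      = 2 ^ (Real.logb 2 q * -(c / √(Real.logb 2 (Real.logb 2 (Real.logb 2 q))))) by
        rw [Real.rpow_mul (by norm_num), Real.rpow_logb (by norm_num) (by norm_num) hq0]]
    apply hpow
    have h6 : c / √(Real.logb 2 (Real.logb 2 (Real.logb 2 q))) ≤ c / (√v / 2) := by gcongr
    have h7 : Real.logb 2 q * (c / √(Real.logb 2 (Real.logb 2 (Real.logb 2 q)))) ≤ L * (c / (√v / 2)) :=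
      mul_le_mul h2 h6 (by positivity) (by linarith)
    have h8 : L * (c / (√v / 2)) = E := by rw [hE]; field_simp
    linarith
  refine ⟨by positivity, ?_, by linarith, Real.one_le_rpow (by norm_num) hE0, ?_, ?_, ?_, hr,
    fun q hq => hq.2.1.1, ?_, ?_, hdist, ?_⟩
  · exact one_le_mul_of_one_le_of_one_le (by linarith) (one_le_pow₀ (by linarith))
  · have h1 : (1 + L) ^ 2 ≤ (2 ^ (1 + u)) ^ 2 := by
      have : (2 : ℝ) ^ u = L := by rw [hu, Real.rpow_logb (by norm_num) (by norm_num) (by linarith)]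
      rw [Real.rpow_add (by norm_num), this, Real.rpow_one]
      gcongr
      linarith
    refine h1.trans ?_
    rw [← Real.rpow_natCast, ← Real.rpow_mul (by norm_num)]
    apply hpow
    push_cast
    nlinarith
  · exact hpow _ _ (by linarith)
  · rw [hrL]; exact hpow _ _ (by linarith)
  -- With `2 Y ^ 2 ≤ 2 ^ (24 E)` the exponent `C √v` gives the lower bound `2 ^ (-1 - 48 C c L)`:
  -- the `√v` in the exponent cancels the one in `E`. Since `200 C c ≤ 1`, this exceeds `Y ^ 7 / r =
  -- 2 ^ (56 E - L)`.
  · intro k₁ k₂ h1 h2 hne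
    have hY2 : 2 * ((2 : ℝ) ^ (8 * E)) ^ 2 ≤ 2 ^ (24 * E) := by
      rw [hYn]
      have : (2 : ℝ) ^ (24 * E) = 2 ^ (8 * E) * 2 ^ (8 * E * (2 : ℕ)) := by
        rw [← Real.rpow_add (by norm_num)]; congr 1; push_cast; ring
      rw [this]
      gcongr
      calc (2 : ℝ) = 2 ^ (1 : ℝ) := by rw [Real.rpow_one]
        _ ≤ _ := hpow _ _ (by nlinarith)
    have hs : 0 ≤ C * √v := by positivity
    have h3 := hadm.le_distInt hs (hY2.trans (by rw [hrL]; exact hpow _ _ (by linarith))) h1 h2 hne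
    refine le_trans ?_ h3
    have h4 : ((2 : ℝ) ^ (24 * E)) ^ (-(C * √v)) ≤ (2 * ((2 : ℝ) ^ (8 * E)) ^ 2) ^ (-(C * √v)) :=
      Real.rpow_le_rpow_of_nonpos (by positivity) hY2 (by linarith)
    have h5 : (1 : ℝ) / 2 * ((2 : ℝ) ^ (24 * E)) ^ (-(C * √v))
        ≤ 1 / 2 * (2 * ((2 : ℝ) ^ (8 * E)) ^ 2) ^ (-(C * √v)) := by gcongr
    refine le_trans ?_ h5
    rw [hYn, hrL, ← Real.rpow_mul (by norm_num), ← Real.rpow_sub (by norm_num),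
      show (1 : ℝ) / 2 = 2 ^ (-1 : ℝ) by rw [Real.rpow_neg_one]; norm_num,
      ← Real.rpow_add (by norm_num)]
    apply hpow
    have h6 : 24 * E * -(C * √v) = -(48 * (C * c * L)) := by linear_combination (-24 * C) * hEX
    rw [h6]
    push_cast
    nlinarith
  · intro q hq hqr
    refine le_trans ?_ hq.2.2
    have hq0 : (1 : ℝ) ≤ q := by exact_mod_cast hq.2.1.1
    have h1 : 0 ≤ Real.logb 2 q := Real.logb_nonneg (by norm_num) hq0
    have h2 : Real.logb 2 q ≤ L := by
      rw [hL]; exact Real.logb_le_logb_of_le (by norm_num) (by linarith) (by exact_mod_cast hqr)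
    gcongr
  · intro q hq hqr1 hqr2
    have hq0 : (0 : ℝ) < q := by exact_mod_cast hq.2.1.1
    obtain ⟨h1, h2, h3, h4, h5⟩ := logb_facts_of_le_mul hq.2.1.1 hL hu hv hv4 hu2 hL4 hqr1 (hqr q hqr2)
    have hd : 0 < distInt (q * β - γ') := lt_of_lt_of_le (by positivity) (hdist q hq hqr1 hqr2)
    have h6 := hψ q hq.1
    have h7 : A / (q * Real.logb 2 q * Real.logb 2 (Real.logb 2 q) ^ 3)
        ≤ A / (q * (L / 2) * (u / 2) ^ 3) := by
      have h8 : 0 ≤ Real.logb 2 q := by linarith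
      gcongr
    calc ψ q / distInt (q * β - γ') ≤ A / (q * (L / 2) * (u / 2) ^ 3) / distInt (q * β - γ') := by
          gcongr; exact h6.trans h7
      _ = _ := by field_simp; norm_num

end Row

theorem lt_two_rpow_self (x : ℝ) (hx : 0 ≤ x) : x < 2 ^ x := by
  have h1 : x < ⌊x⌋₊ + 1 := Nat.lt_floor_add_one x
  have h2 : ((⌊x⌋₊ + 1 : ℕ) : ℝ) ≤ ((2 ^ ⌊x⌋₊ : ℕ) : ℝ) := Nat.cast_le.2 Nat.lt_two_pow_self
  have h3 : (2 : ℝ) ^ ((⌊x⌋₊ : ℕ) : ℝ) ≤ 2 ^ x :=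
    Real.rpow_le_rpow_of_exponent_le (by norm_num) (Nat.floor_le hx)
  rw [Real.rpow_natCast] at h3
  push_cast at h2
  linarith

/-- By `hT` the exponent `C √v` costs at most `2 ^ (5 E)` at height `2 T`, so `‖kγ‖ ≥ 2 ^ (-5 E) /
2`, whereas `Z² / Y = 2 ^ (-6 E)`. The spare factor `2 ^ E` beats the constant `128 A`. -/
theorem gap_of_isAdmissibleExponent {γ β c A C L v E : ℝ} {r T : ℕ} (hA : 0 < A) (hC : 5 ≤ C)
    (hc : 0 < c) (hcC : 200 * C * c ≤ 1) (hrL : (r : ℝ) = 2 ^ L) (hE : E = 2 * c * L / √v)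
    (hv4 : 4 ≤ v) (hL : 0 ≤ L) (hAE : 128 * A < E) (hadm : IsAdmissibleExponent γ β r (C * √v))
    (hT0 : 0 < T) (hT : Real.logb 2 T + 1 ≤ 10 * c / C * L / v) :
    (T : ℝ) ≤ 2 ^ E ∧
      ∀ k : ℕ, 0 < k → k ≤ T → 4 * (16 * A) * (2 ^ E) ^ 2 / 2 ^ (8 * E) < distInt (k * γ) := by
  have hT' : (0 : ℝ) < T := by exact_mod_cast hT0
  have hX0 : 0 < √v := Real.sqrt_pos.2 (by linarith)
  have hX1 : 1 ≤ √v := by rw [Real.one_le_sqrt]; linarith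
  have hvX : √v * √v = v := Real.mul_self_sqrt (by linarith)
  have hpow : ∀ x y : ℝ, x ≤ y → (2 : ℝ) ^ x ≤ 2 ^ y := fun x y h =>
    Real.rpow_le_rpow_of_exponent_le (by norm_num) h
  have hE0 : 0 ≤ E := by rw [hE]; positivity
  have hEX : E * √v = 2 * c * L := by rw [hE]; field_simp
  have hTv : C * √v * (Real.logb 2 T + 1) ≤ 5 * E := by
    calc C * √v * (Real.logb 2 T + 1) ≤ C * √v * (10 * c / C * L / v) := by gcongr
      _ = 10 * c * L * √v / (√v * √v) := by rw [hvX]; field_simp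
      _ = 5 * E := by rw [hE]; field_simp; ring
  have hT1 : Real.logb 2 T + 1 ≤ E := by
    have h0 : 0 ≤ Real.logb 2 T := Real.logb_nonneg (by norm_num) (by exact_mod_cast hT0)
    have : 5 ≤ C * √v := by nlinarith
    nlinarith
  have hEL : E ≤ L := by
    have : E ≤ 2 * c * L := by rw [← hEX]; exact le_mul_of_one_le_right hE0 hX1
    nlinarith
  have h2T : 2 * (T : ℝ) = 2 ^ (Real.logb 2 T + 1) := by
    rw [Real.rpow_add (by norm_num), Real.rpow_logb (by norm_num) (by norm_num) hT', Real.rpow_one,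
      mul_comm]
  refine ⟨?_, fun k hk hkT => ?_⟩
  · have := hpow _ _ hT1
    rw [← h2T] at this
    linarith
  · have h1 := hadm.le_distInt (H := T) (by positivity) (by rw [h2T, hrL]; exact hpow _ _ (by linarith))
      (k₁ := k) (k₂ := 0) (by rw [Nat.abs_cast]; exact_mod_cast hkT) (by simp) (by simp; omega)
    simp only [Int.cast_natCast, Int.cast_zero, zero_mul, add_zero] at h1
    refine lt_of_lt_of_le ?_ h1
    rw [h2T, ← Real.rpow_mul (by norm_num)]
    have h2 : (2 : ℝ) ^ (-(5 * E)) ≤ 2 ^ ((Real.logb 2 T + 1) * -(C * √v)) :=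
      hpow _ _ (by linarith)
    have h3 : (4 : ℝ) * (16 * A) * (2 ^ E) ^ 2 / 2 ^ (8 * E) = 64 * A * 2 ^ (-(6 * E)) := by
      rw [mul_div_assoc, ← Real.rpow_natCast, ← Real.rpow_mul (by norm_num),
        ← Real.rpow_sub (by norm_num)]
      rw [show E * ((2 : ℕ) : ℝ) - 8 * E = -(6 * E) by push_cast; ring]
      ring
    have h4 : (2 : ℝ) ^ (-(5 * E)) = 2 ^ E * 2 ^ (-(6 * E)) := by
      rw [← Real.rpow_add (by norm_num)]; congr 1; ring
    have h5 : E < 2 ^ E := lt_two_rpow_self E hE0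
    have h6 : (0 : ℝ) < 2 ^ (-(6 * E)) := by positivity
    rw [h3]
    nlinarith

/-- The factor `L u ^ 3` is used up exactly: `L` by the scales of `‖qβ - γ'‖`, one `u` by the scales
of `r / q`, and `u ^ 2` by the divisor sum. -/
theorem rowConstant_le {A K L u : ℝ} {r : ℕ} (hA : 0 < A) (hK : 1 ≤ K) (hrL : (r : ℝ) = 2 ^ L)
    (hu : u = Real.logb 2 L) (hu2 : 2 ≤ u) (hL4 : 4 ≤ L) (hKu : K ≤ u) :
    148480 * (Real.logb 2 K + 1 + Real.logb 2 ((1 + L) ^ 2)) * (Real.logb 2 r + 1)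
        * (8 + Real.log (Real.log r + 1)) ^ 2 * (16 * A) / (L * u ^ 3) ≤ 148480 * 19200 * A := by
  have hl2 : 0 < Real.log 2 := Real.log_pos (by norm_num)
  have hl21 : Real.log 2 ≤ 1 := by linarith [Real.log_two_lt_d9]
  have h2L : Real.logb 2 (2 * L) = 1 + u := by
    rw [Real.logb_mul (by norm_num) (by linarith), Real.logb_self_eq_one (by norm_num), hu]
  have h1L : Real.logb 2 (1 + L) ≤ 1 + u := by
    rw [← h2L]; exact Real.logb_le_logb_of_le (by norm_num) (by linarith) (by linarith)
  have h1 : Real.logb 2 ((1 + L) ^ 2) ≤ 2 * (1 + u) := by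
    rw [← Real.rpow_natCast, Real.logb_rpow_eq_mul_logb_of_pos (by linarith)]
    push_cast; linarith
  have h2 : Real.logb 2 K ≤ u := by
    refine le_trans ?_ hKu
    rw [Real.logb_le_iff_le_rpow (by norm_num) (by linarith)]
    exact (lt_two_rpow_self K (by linarith)).le
  have h3 : Real.logb 2 r = L := by rw [hrL, Real.logb_rpow (by norm_num) (by norm_num)]
  have h4 : Real.log r = L * Real.log 2 := by rw [hrL, Real.log_rpow (by norm_num)]
  have h5 : Real.log (Real.log r + 1) ≤ 1 + u := by
    have h6 : Real.log r + 1 ≤ 1 + L := by rw [h4]; nlinarith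
    have h7 : Real.log (Real.log r + 1) ≤ Real.log (1 + L) :=
      Real.log_le_log (by rw [h4]; positivity) h6
    have h8 : Real.log (1 + L) ≤ Real.logb 2 (1 + L) := by
      rw [Real.logb, le_div_iff₀ hl2]
      have := Real.log_nonneg (show 1 ≤ 1 + L by linarith)
      nlinarith
    linarith
  have h6 : 0 ≤ Real.log (Real.log r + 1) := Real.log_nonneg (by rw [h4]; nlinarith)
  have h7 : 0 ≤ Real.logb 2 K := Real.logb_nonneg (by norm_num) hK
  have h8 : 0 ≤ Real.logb 2 ((1 + L) ^ 2) :=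
    Real.logb_nonneg (by norm_num) (one_le_pow₀ (by linarith))
  rw [h3, div_le_iff₀ (by positivity)]
  have e1 : Real.logb 2 K + 1 + Real.logb 2 ((1 + L) ^ 2) ≤ 6 * u := by linarith
  have e2 : L + 1 ≤ 2 * L := by linarith
  have e3 : 8 + Real.log (Real.log r + 1) ≤ 10 * u := by linarith
  calc _ ≤ 148480 * (6 * u) * (2 * L) * (10 * u) ^ 2 * (16 * A) := by gcongr
    _ = _ := by ring

theorem eventually_isAdmissibleExponent {γ β C₀ : ℝ}
    (hσ : ∀ᶠ q : ℕ in atTop,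
      jointExponent γ β q ≤ ENNReal.ofReal (C₀ * Real.sqrt (log₂ (log₂ (log₂ q))))) :
    ∀ᶠ q : ℕ in atTop, IsAdmissibleExponent γ β q
      ((|C₀| + 5) * √(Real.logb 2 (Real.logb 2 (Real.logb 2 q)))) := by
  have ht : Tendsto (Real.logb 2) atTop atTop := Real.tendsto_logb_atTop (by norm_num)
  have ht3 : Tendsto (fun q : ℕ => Real.logb 2 (Real.logb 2 (Real.logb 2 q))) atTop atTop :=
    ht.comp (ht.comp (ht.comp tendsto_natCast_atTop_atTop))
  filter_upwards [hσ, ht3.eventually_ge_atTop 1] with q h1 h2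
  apply isAdmissibleExponent_of_jointExponent_lt
  refine h1.trans_lt ?_
  have h3 : 0 < √(Real.logb 2 (Real.logb 2 (Real.logb 2 q))) := Real.sqrt_pos.2 (by linarith)
  rw [ENNReal.ofReal_lt_ofReal_iff (by positivity)]
  simp only [log₂]
  have := le_abs_self C₀
  gcongr
  linarith

/-! ### Assembly: the row estimate for large `r`, divergence, and the theorem. -/

theorem eventually_sum_gcd_le {ψ : ℕ → ℝ} {γ β γ' c A C : ℝ} {q₀ : ℕ} {f : ℕ → ℝ} {S : Set ℕ}
    (hf : f = fun q => ψ q / distInt (q * β - γ')) (hS : S = largeRadiusSet f β γ' c q₀)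
    (hA : 0 < A) (hC : 5 ≤ C) (hc : 0 < c) (hcC : 200 * C * c ≤ 1)
    (hψ : ∀ q : ℕ, q₀ ≤ q → ψ q ≤ A / (q * Real.logb 2 q * Real.logb 2 (Real.logb 2 q) ^ 3))
    (hadm : ∀ᶠ q : ℕ in atTop, IsAdmissibleExponent γ β q
      (C * √(Real.logb 2 (Real.logb 2 (Real.logb 2 q))))) (K : ℝ) (hK : 1 ≤ K) :
    ∀ᶠ r : ℕ in atTop, r ∈ S → ∀ Q : Finset ℕ, (∀ q ∈ Q, q ∈ S) → (∀ q ∈ Q, q < r) →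
      (∀ q ∈ Q, max (f q / q) (f r / r) * (q * r / q.gcd r) < K) →
      (∀ q ∈ Q, distInt ((q / q.gcd r : ℕ) * γ - (r / q.gcd r : ℕ) * γ)
        ≤ 2 * max (f q / q) (f r / r) * (q * r / q.gcd r)) →
      ∑ q ∈ Q, (q.gcd r) * min (f q / q) (f r / r) ≤ (2 + 148480 * 19200 * A) * f r := by
  subst hf
  subst hS
  have ht : Tendsto (fun q : ℕ => Real.logb 2 q) atTop atTop :=
    (Real.tendsto_logb_atTop (by norm_num)).comp tendsto_natCast_atTop_atTop
  set M := 4 + K + 128 * A with hM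
  filter_upwards [hadm, ht.eventually (eventually_iterated_logb M c (10 * c / C) hc (by positivity)),
    eventually_gt_atTop 0] with r hadm hev hr0 hr Q hQS hQr hQK hQclose
  obtain ⟨-, hvM, hu2, hL4, hMu, hτ⟩ := hev
  set L := Real.logb 2 r with hL
  set u := Real.logb 2 L with hu
  set v := Real.logb 2 u with hv
  set E := 2 * c * L / √v with hE
  have hr' : (0 : ℝ) < r := by exact_mod_cast hr0
  have hrL : (r : ℝ) = 2 ^ L := by rw [hL, Real.rpow_logb (by norm_num) (by norm_num) hr']
  have hv4 : 4 ≤ v := by linarith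
  have hvu : v < u := by
    have := lt_two_rpow_self v (by linarith)
    rwa [hv, Real.rpow_logb (by norm_num) (by norm_num) (by linarith)] at this
  have hB := rowBounds_of_large hA hC hc hcC hψ hL hu hv hE hv4 hu2 hL4 (by linarith) hMu hadm hr
  have hME : M < E := by nlinarith
  have hτ' : Real.logb 2 r.divisors.card + 1 ≤ 10 * c / C * L / v := by
    have := logb_card_divisors_le r hr0.ne' hL4 (by linarith)
    linarith
  have hT0 : 0 < r.divisors.card := Finset.card_pos.2 ⟨1, Nat.one_mem_divisors.2 hr0.ne'⟩
  obtain ⟨hTZ, hgap⟩ := gap_of_isAdmissibleExponent hA hC hc hcC hrL hE hv4 (by linarith)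
    (by linarith) hadm hT0 hτ'
  have hKY : K ≤ 2 ^ (8 * E) := by
    have := lt_two_rpow_self (8 * E) (by linarith)
    linarith
  have hfr := hB.f_pos hr le_rfl
  refine (hB.sum_gcd_le hK hKY hTZ hgap Q hQS hQr ?_ hQclose).trans ?_
  -- Since `f q ≥ 1 / (q (1 + L)²)`, a parameter below `K` forces `r ≤ K gcd(q, r) (1 + L)² q`,
  -- which limits the number of scales of `r / q`.
  · intro q hq
    have hq0 : (0 : ℝ) < q := by exact_mod_cast hB.pos q (hQS q hq)
    have hg0 : (0 : ℝ) < q.gcd r := by exact_mod_cast Nat.gcd_pos_of_pos_right q hr0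
    have h1 := (mul_le_mul_of_nonneg_right (le_max_left (ψ q / distInt (q * β - γ') / q)
      (ψ r / distInt (r * β - γ') / r)) (show (0 : ℝ) ≤ q * r / q.gcd r by positivity)).trans (hQK q hq).le
    have h2 := hB.low q (hQS q hq) (hQr q hq).le
    have h3 : 1 / (q * (1 + L) ^ 2) / q * (q * r / q.gcd r) ≤ K := le_trans (by gcongr) h1
    have h4 : 1 / ((q : ℝ) * (1 + L) ^ 2) / q * (q * r / q.gcd r) = r / (q.gcd r * (1 + L) ^ 2 * q) := by
      field_simp
    rw [h4, div_le_iff₀ (by positivity)] at h3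
    linarith
  · rw [mul_comm]
    have := rowConstant_le hA hK hrL hu hu2 hL4 (by linarith)
    gcongr

/-- What is removed from the divergent sum is a finite set of indices and terms dominated by a
convergent series. -/
theorem not_summable_indicator_largeRadiusSet {f : ℕ → ℝ} {β γ' c : ℝ} {q₀ : ℕ} (hf : ∀ q, 0 ≤ f q)
    (h : ∑' q : sumRange (omegaFun c) β γ', ENNReal.ofReal (f q) = ⊤) :
    ¬ Summable ((largeRadiusSet f β γ' c q₀).indicator f) := by
  intro hs
  have h1 : Summable ((Set.Iio q₀).indicator f) :=
    summable_of_hasFiniteSupport ((Set.finite_Iio q₀).subset Set.support_indicator_subset)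
  have h2 : Summable ((sumRange (omegaFun c) β γ').indicator f) := by
    refine Summable.of_nonneg_of_le (fun q => Set.indicator_nonneg (fun q _ => hf q) q) (fun q => ?_)
      ((hs.add h1).add summable_one_div_mul_sq_one_add_logb)
    have e1 : 0 ≤ (largeRadiusSet f β γ' c q₀).indicator f q :=
      Set.indicator_nonneg (fun q _ => hf q) q
    have e2 : 0 ≤ (Set.Iio q₀).indicator f q := Set.indicator_nonneg (fun q _ => hf q) q
    have e3 : 0 ≤ 1 / ((q : ℝ) * (1 + Real.logb 2 q) ^ 2) := by positivity
    by_cases hq : q ∈ sumRange (omegaFun c) β γ'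
    · rw [Set.indicator_of_mem hq]
      by_cases hq0 : q < q₀
      · rw [Set.indicator_of_mem (s := Set.Iio q₀) hq0] at e2 ⊢
        linarith
      · by_cases hq1 : 1 / (q * (1 + Real.logb 2 q) ^ 2) ≤ f q
        · have : q ∈ largeRadiusSet f β γ' c q₀ := ⟨not_lt.1 hq0, hq, hq1⟩
          rw [Set.indicator_of_mem this] at e1 ⊢
          linarith
        · linarith [not_le.1 hq1]
    · rw [Set.indicator_of_notMem hq]
      linarith
  exact ((summable_subtype_iff_indicator.2 h2).tsum_ofReal_ne_top) h

theorem volume_fibredSet_eq_one {ψ : ℕ → ℝ} {β γ γ' : ℝ} {S : Set ℕ} (hS0 : ∀ q ∈ S, 0 < q)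
    (hS : ∀ q ∈ S, 0 < distInt (q * β - γ'))
    (h : volume {x : UnitAddCircle | {q : ℕ | q ∈ S ∧
      x ∈ approxSet q γ (ψ q / distInt (q * β - γ'))}.Infinite} = 1) :
    volume (fibredSet ψ β γ γ') = 1 := by
  set B := {x : UnitAddCircle | {q : ℕ | q ∈ S ∧
      x ∈ approxSet q γ (ψ q / distInt (q * β - γ'))}.Infinite} with hB
  have hBm : MeasurableSet B := by
    have : B = ⋂ N : ℕ, ⋃ q : ℕ, ⋃ _ : N < q ∧ q ∈ S,
        approxSet q γ (ψ q / distInt (q * β - γ')) := by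
      ext x
      simp only [hB, Set.mem_ofPred_eq, Set.infinite_iff_exists_gt, Set.mem_iInter, Set.mem_iUnion]
      refine forall_congr' fun N => exists_congr fun q => ?_
      simp only [exists_prop]
      tauto
    rw [this]
    exact MeasurableSet.iInter fun N => MeasurableSet.iUnion fun q => MeasurableSet.iUnion fun _ =>
      measurableSet_approxSet _ _ _
  apply le_antisymm
  · calc volume (fibredSet ψ β γ γ') ≤ volume (Set.Icc (0 : ℝ) 1) :=
          measure_mono fun x hx => hx.1
      _ = 1 := by simp
  · have hp := (UnitAddCircle.measurePreserving_mk 0).measure_preimage hBm.nullMeasurableSet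
    rw [h, Measure.restrict_apply (AddCircle.measurable_mk' hBm)] at hp
    rw [← hp]
    apply measure_mono
    rintro x ⟨hx, hx01⟩
    rw [zero_add] at hx01
    refine ⟨⟨hx01.1.le, hx01.2⟩, Set.Infinite.mono ?_ hx⟩
    rintro q ⟨hq, hxq⟩
    refine ⟨hS0 q hq, ?_⟩
    rw [approxSet, Set.mem_ofPred_eq, lt_div_iff₀ (hS q hq)] at hxq
    have : distInt (q * x - γ) = ‖q • (x : UnitAddCircle) - (γ : UnitAddCircle)‖ := by
      rw [distInt_eq_norm, ← AddCircle.coe_nsmul, ← AddCircle.coe_sub, nsmul_eq_mul]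
    rwa [this]

theorem theorem1p3 (ψ : ℕ → ℝ) (hψ0 : ∀ q, 0 ≤ ψ q)
    (hψ : ψ =O[atTop] fun q : ℕ => ((q : ℝ) * log₂ q * (log₂ (log₂ q)) ^ 3)⁻¹)
    (γ β : ℝ) (hγ : Irrational γ) (hβ : Irrational β)
    (hσ : ∃ C : ℝ, ∀ᶠ q : ℕ in atTop,
      jointExponent γ β q ≤ ENNReal.ofReal (C * Real.sqrt (log₂ (log₂ (log₂ q)))))
    (ε : ℝ) (hε : 0 < ε) :
    ∃ c : ℝ, 0 < c ∧ c < ε ∧ ∀ γ' : ℝ,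
      (∑' q : sumRange (omegaFun c) β γ',
          ENNReal.ofReal (ψ q / distInt (((q : ℕ) : ℝ) * β - γ')) = ⊤) →
        volume (fibredSet ψ β γ γ') = 1 := by
  obtain ⟨C₀, hσ⟩ := hσ
  have hadm := eventually_isAdmissibleExponent hσ
  set C := |C₀| + 5 with hCdef
  have hC : 5 ≤ C := by rw [hCdef]; linarith [abs_nonneg C₀]
  -- The bound `1 / (200 C)` is the margin needed in the Diophantine comparisons. It depends only on
  -- the exponent hypothesis, so `c` does not involve `γ'`.
  set c := min (ε / 2) (1 / (200 * C)) with hcdef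
  have hc : 0 < c := lt_min (by positivity) (by positivity)
  have hcC : 200 * C * c ≤ 1 := by
    have : c ≤ 1 / (200 * C) := min_le_right _ _
    rw [le_div_iff₀ (by positivity)] at this
    linarith
  refine ⟨c, hc, lt_of_le_of_lt (min_le_left _ _) (by linarith), fun γ' hdiv => ?_⟩
  obtain ⟨A, hA, hψ⟩ := hψ.exists_pos
  have ht : Tendsto (Real.logb 2) atTop atTop := Real.tendsto_logb_atTop (by norm_num)
  have ht3 : Tendsto (fun q : ℕ => Real.logb 2 (Real.logb 2 (Real.logb 2 q))) atTop atTop :=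
    ht.comp (ht.comp (ht.comp tendsto_natCast_atTop_atTop))
  have ht2 : Tendsto (fun q : ℕ => Real.logb 2 (Real.logb 2 q)) atTop atTop :=
    ht.comp (ht.comp tendsto_natCast_atTop_atTop)
  have ht1 : Tendsto (fun q : ℕ => Real.logb 2 q) atTop atTop :=
    ht.comp tendsto_natCast_atTop_atTop
  -- Beyond `q₀` the second branch of `ω` applies and `ω q ≤ c`; `q ≥ 4 A² + 1` gives `2 A ≤ √q`,
  -- needed for radii at most `1 / 2`.
  obtain ⟨q₀, hq₀⟩ := eventually_atTop.1 (hψ.bound.and ((ht1.eventually_ge_atTop 1).and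
    ((ht2.eventually_ge_atTop 2).and ((ht3.eventually_ge_atTop 1).and
    (tendsto_natCast_atTop_atTop.eventually_ge_atTop (4 * A ^ 2 + 1 : ℝ))))))
  have hψ' : ∀ q : ℕ, q₀ ≤ q → ψ q ≤ A / (q * Real.logb 2 q * Real.logb 2 (Real.logb 2 q) ^ 3) := by
    intro q hq
    obtain ⟨h1, h2, h3, -⟩ := hq₀ q hq
    simp only [log₂] at h1
    rw [Real.norm_of_nonneg (hψ0 q), Real.norm_of_nonneg (by positivity)] at h1
    rwa [div_eq_mul_inv]
  set f : ℕ → ℝ := fun q => ψ q / distInt (q * β - γ') with hf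
  set S := largeRadiusSet f β γ' c q₀ with hS
  have hf0 : ∀ q, 0 ≤ f q := fun q => div_nonneg (hψ0 q) (distInt_nonneg _)
  have hS0 : ∀ q ∈ S, 0 < q := fun q hq => hq.2.1.1
  have hSf : ∀ q ∈ S, 0 < f q := by
    intro q hq
    have h1 : (1 : ℝ) ≤ q := by exact_mod_cast hS0 q hq
    have h2 : 0 ≤ Real.logb 2 q := Real.logb_nonneg (by norm_num) h1
    exact lt_of_lt_of_le (by positivity) hq.2.2
  have hSd : ∀ q ∈ S, 0 < distInt (q * β - γ') := by
    intro q hq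
    have h1 : (0 : ℝ) < q := by exact_mod_cast hS0 q hq
    exact lt_of_lt_of_le (by positivity) hq.2.1.2.1
  have hSf1 : ∀ q ∈ S, f q ≤ 1 / 2 := by
    intro q hq
    have h1 : (0 : ℝ) < q := by exact_mod_cast hS0 q hq
    have h1' : (1 : ℝ) ≤ q := by exact_mod_cast hS0 q hq
    obtain ⟨-, h2, h3, h4, h5⟩ := hq₀ q hq.1
    have h6 : ψ q ≤ A / q := by
      refine (hψ' q hq.1).trans ?_
      have : 1 ≤ Real.logb 2 q * Real.logb 2 (Real.logb 2 q) ^ 3 :=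
        one_le_mul_of_one_le_of_one_le h2 (one_le_pow₀ (by linarith))
      rw [mul_assoc]
      apply div_le_div_of_nonneg_left hA.le h1
      exact le_mul_of_one_le_right h1.le this
    have h7 : 1 / √q ≤ distInt (q * β - γ') := by
      refine le_trans ?_ hq.2.1.2.1
      rw [Real.sqrt_eq_rpow, one_div, ← Real.rpow_neg h1.le]
      apply Real.rpow_le_rpow_of_exponent_le h1'
      rw [omegaFun, log₂, log₂, if_neg (by linarith), log₂]
      have h8 : 1 ≤ √(Real.logb 2 (Real.logb 2 (Real.logb 2 q))) := Real.one_le_sqrt.2 h4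
      have h9 : c / √(Real.logb 2 (Real.logb 2 (Real.logb 2 q))) ≤ c := div_le_self hc.le h8
      have h10 : c ≤ 1 / 2 := by nlinarith
      linarith
    have h8 : 2 * A ≤ √q := by
      apply Real.le_sqrt_of_sq_le
      nlinarith
    have h9 : 0 < √(q : ℝ) := Real.sqrt_pos.2 h1
    rw [hf]
    dsimp only
    rw [div_le_iff₀ (hSd q hq)]
    calc ψ q ≤ A / q := h6
      _ = A / (√q * √q) := by rw [Real.mul_self_sqrt h1.le]
      _ = A / √q * (1 / √q) := by field_simp
      _ ≤ 1 / 2 * (1 / √q) := by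
          refine mul_le_mul_of_nonneg_right ?_ (by positivity)
          rw [div_le_iff₀ h9]
          linarith
      _ ≤ _ := by gcongr
  apply volume_fibredSet_eq_one hS0 hSd
  refine volume_setOf_infinite_eq_one S f γ hS0 hSf hSf1
    (not_summable_indicator_largeRadiusSet hf0 hdiv) fun K hK => ?_
  obtain ⟨r₀, hr₀⟩ := eventually_atTop.1
    (eventually_sum_gcd_le hf hS hA hC hc hcC hψ' hadm K hK)
  refine ⟨max (2 + 148480 * 19200 * A) r₀, fun r hr Q hQS hQr hQK hQc => ?_⟩
  have hfr := hSf r hr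
  have hr' : (0 : ℝ) < r := by exact_mod_cast hS0 r hr
  rcases le_or_gt r₀ r with h | h
  · refine (hr₀ r h hr Q hQS hQr hQK hQc).trans ?_
    gcongr
    exact le_max_left _ _
  -- For `r < r₀` the trivial bound `f r` per term suffices, as there are fewer than `r₀` terms.
  · have hterm : ∀ q ∈ Q, (q.gcd r) * min (f q / q) (f r / r) ≤ f r := by
      intro q _
      have h1 : ((q.gcd r : ℕ) : ℝ) ≤ r := by
        exact_mod_cast Nat.le_of_dvd (hS0 r hr) (Nat.gcd_dvd_right q r)
      calc (q.gcd r) * min (f q / q) (f r / r) ≤ r * (f r / r) := by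
            have h3 : min (f q / q) (f r / r) ≤ f r / r := min_le_right _ _
            have h4 : 0 ≤ f r / r := by positivity
            calc _ ≤ (q.gcd r : ℝ) * (f r / r) := by gcongr
              _ ≤ _ := by gcongr
        _ = f r := by field_simp
    refine (Finset.sum_le_card_nsmul _ _ _ hterm).trans ?_
    rw [nsmul_eq_mul]
    have hcard : Q.card ≤ r₀ := by
      calc Q.card ≤ (Finset.range r).card :=
            Finset.card_le_card fun q hq => Finset.mem_range.2 (hQr q hq)
        _ ≤ r₀ := by rw [Finset.card_range]; exact h.le
    have h5 : (Q.card : ℝ) ≤ max (2 + 148480 * 19200 * A) r₀ :=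
      le_max_of_le_right (by exact_mod_cast hcard)
    gcongr
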